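/- Let $d\gamma=(2\pi)^{-1/2}e^{-x^2/2}\,dx$ on $\mathbb{R}$. For a measure $\mu$ on $\mathbb{R}$ write $\|g\|_{W^{1,1}(\mathbb{R},\mu)}=\int|g|\,d\mu+\int|g'|\,d\mu$, where $g'$ denotes the weak derivative. (1) For every real $\alpha$ there exists a constant $a_\alpha>0$, depending only on $\alpha$, such that the following holds. Let $f\ge 0$ be a function in $L^1(\mathbb{R},d\gamma)$ with $\sqrt f\in W^{1,2}(\mathbb{R},d\gamma)$ that is normalized and centered, i.e. $\int f\,d\gamma=1$ and $\int x f\,d\gamma=0$, and suppose $\int |x|^2 f\,d\gamma\le\alpha<\infty$. Then the logarithmic Sobolev deficit $$\delta(f)=\frac12\int\frac{|f'|^2}{f}\,d\gamma-\int f\log f\,d\gamma$$ is well defined (both integrals converge absolutely, the first integrand being $0$ where $f=0$) and nonnegative, $f-1\in W^{1,1}(\mathbb{R},d\gamma)$, and $$\|f-1\|_{W^{1,1}(\mathbb{R},d\gamma)}\le a_\alpha\Big(\delta(f)^{1/4}+\delta(f)^{3/4}\Big).$$ (2) For every real $\alpha$ there exists a constant $\overline a_\alpha>0$, depending only on $\alpha$,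 such that the following holds. Let $u\ge 0$ be a function in $W^{1,2}(\mathbb{R},e^{-\pi x^2}dx)$ that is normalized and centered, i.e. $\int u^2e^{-\pi x^2}dx=1$ and $\int x\,u^2e^{-\pi x^2}dx=0$, and suppose $\int |x|^2u^2e^{-\pi x^2}dx\le\alpha<\infty$. Then $$\delta_*(u)=\frac1\pi\int|u'|^2e^{-\pi x^2}dx-\int u^2\log (u^2)\,e^{-\pi x^2}dx$$ is well defined (both integrals converge absolutely) and nonnegative, $u-1\in W^{1,1}(\mathbb{R},e^{-\pi x^2}dx)$, and $$\|u-1\|_{W^{1,1}(\mathbb{R},e^{-\pi x^2}dx)}\le\overline a_\alpha\big(\delta_*(u)^{1/4}+\delta_*(u)\big).$$ -/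

import Mathlib

open MeasureTheory ProbabilityTheory
open scoped ENNReal ContDiff

namespace LSIStability

/-- `g` is a weak (distributional) derivative of `f` on the real line: both are locally integrable
and `∫ f φ' = - ∫ g φ` for every smooth compactly supported test function `φ`. -/
def HasWeakDeriv (f g : ℝ → ℝ) : Prop :=
  LocallyIntegrable f volume ∧ LocallyIntegrable g volume ∧
    ∀ φ : ℝ → ℝ, ContDiff ℝ ∞ φ → HasCompactSupport φ →
      ∫ x, f x * deriv φ x = -∫ x, g x * φ x

/-- A weak derivative is unique up to Lebesgue-null sets. -/
theorem HasWeakDeriv.ae_eq {f g h : ℝ → ℝ} (hg : HasWeakDeriv f g) (hh : HasWeakDeriv f h) :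
    g =ᵐ[volume] h := by
  refine ae_eq_of_integral_contDiff_smul_eq hg.2.1 hh.2.1 fun φ hφ hc => ?_
  have h1 := hg.2.2 φ hφ hc
  have h2 := hh.2.2 φ hφ hc
  simp only [smul_eq_mul, mul_comm (φ _)]
  linarith

open Classical in
/-- The weak derivative of `f` (a choice of representative; `0` if there is none). -/
noncomputable def weakDeriv (f : ℝ → ℝ) : ℝ → ℝ :=
  if h : ∃ g, HasWeakDeriv f g then h.choose else 0

theorem hasWeakDeriv_weakDeriv {f : ℝ → ℝ} (h : ∃ g, HasWeakDeriv f g) :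
    HasWeakDeriv f (weakDeriv f) := by
  rw [weakDeriv, dif_pos h]
  exact h.choose_spec

/-- Membership in the weighted Sobolev space `W^{1,p}(ℝ, μ)`. -/
def MemW1p (p : ℝ≥0∞) (μ : Measure ℝ) (f : ℝ → ℝ) : Prop :=
  MemLp f p μ ∧ ∃ g, HasWeakDeriv f g ∧ MemLp g p μ

/-- The norm `∫ |f| dμ + ∫ |f'| dμ` of `W^{1,1}(ℝ, μ)`. -/
noncomputable def w11Norm (μ : Measure ℝ) (f : ℝ → ℝ) : ℝ :=
  ∫ x, |f x| ∂μ + ∫ x, |weakDeriv f x| ∂μ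

/-- The standard Gaussian measure `dγ = (2π)^{-1/2} e^{-x²/2} dx`. -/
noncomputable def γ : Measure ℝ := gaussianReal 0 1

/-- The Gaussian probability measure `e^{-π x²} dx`. -/
noncomputable def γπ : Measure ℝ :=
  volume.withDensity fun x => ENNReal.ofReal (Real.exp (-Real.pi * x ^ 2))

/-- The integrand `|f'|² / f` of the Fisher information. It is `0` where `f = 0`, by the
convention `a / 0 = 0`. -/
noncomputable def fisherIntegrand (f : ℝ → ℝ) (x : ℝ) : ℝ := weakDeriv f x ^ 2 / f x

/-- The deficit `δ(f) = ½ ∫ |f'|² / f dγ - ∫ f log f dγ`. -/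
noncomputable def deficit (f : ℝ → ℝ) : ℝ :=
  1 / 2 * ∫ x, fisherIntegrand f x ∂γ - ∫ x, f x * Real.log (f x) ∂γ

/-- The deficit `δ_*(u)`, where
`π δ_*(u) = ∫ |u'|² e^{-π x²} dx - π ∫ |u|² log |u|² e^{-π x²} dx`. -/
noncomputable def deficitStar (u : ℝ → ℝ) : ℝ :=
  (∫ x, weakDeriv u x ^ 2 ∂γπ - Real.pi * ∫ x, u x ^ 2 * Real.log (u x ^ 2) ∂γπ) / Real.pi

end LSIStability

/-!
Let `T` be the increasing map that transports `f dγ` to `γ`. Integrating the divergence of the flux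
`f 𝔤 (T - id)`, where `𝔤` is the Gaussian density, and using `log T' ≤ T' - 1` gives
`½ ∫ D² f dγ ≤ δ(f)` for the discrepancy `D = (log f)' + (T - id)`. Since `D = 0` for every
translate of `γ`, control of `f'` requires a bound on the displacement `T - id`, and this is where
centering and the second moment enter. The gap `f 𝔤 - 𝔤 ∘ T` has derivative `D f 𝔤`, so Hardy's
inequality bounds its `L¹` norm by `∫ |x D| f dγ`. That norm is also the `L¹(γ)` norm of the
derivative of `y - T⁻¹ y`, a function of mean zero, and the `L¹` Poincaré inequality gives
`∫ |T - id| f dγ ≤ C √δ(f)`, hence `∫ |f'| dγ ≤ C √δ(f)`.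

A density that vanishes somewhere is first mixed with the constant density. For an amplitude `u`,
the density is the dilation of `u²`, and `|u'| ≤ |u u'| + |1 - u| |u'|` bounds `u'` by the
derivative of `u²`.
-/

namespace LSIStability

open Set Filter Topology

local notation "𝔤" => gaussianPDFReal 0 1

/-! ### Primitives and weak derivatives -/

theorem exists_seq_tendsto_zero_atTop {k : ℝ → ℝ} (hk : Integrable k) :
    ∃ b : ℕ → ℝ, Tendsto b atTop atTop ∧ Tendsto (fun n => k (b n)) atTop (𝓝 0) := by
  have h : ∀ n : ℕ, ∃ x : ℝ, (n : ℝ) ≤ x ∧ |k x| < 1 / ((n : ℝ) + 1) := fun n => by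
    by_contra! hcon
    have hfin := hk.measure_norm_ge_lt_top (ε := 1 / ((n : ℝ) + 1)) (by positivity)
    have hsub : Ici (n : ℝ) ⊆ {x | 1 / ((n : ℝ) + 1) ≤ ‖k x‖} := fun x hx => hcon x hx
    simpa using (measure_mono hsub).trans_lt hfin
  choose b hb hkb using h
  exact ⟨b, tendsto_atTop_mono hb tendsto_natCast_atTop_atTop,
    squeeze_zero_norm (fun n => (hkb n).le) tendsto_one_div_add_atTop_nhds_zero_nat⟩

theorem exists_seq_tendsto_zero_atBot {k : ℝ → ℝ} (hk : Integrable k) :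
    ∃ a : ℕ → ℝ, Tendsto a atTop atBot ∧ Tendsto (fun n => k (a n)) atTop (𝓝 0) := by
  obtain ⟨b, hb, hkb⟩ := exists_seq_tendsto_zero_atTop hk.comp_neg
  exact ⟨fun n => -b n, tendsto_neg_atTop_atBot.comp hb, hkb⟩

/-- `f` is locally absolutely continuous and `f'` is a version of its derivative. -/
structure IsPrimitive (f f' : ℝ → ℝ) : Prop where
  locallyIntegrable : LocallyIntegrable f' volume
  integral_eq_sub : ∀ a b, ∫ x in a..b, f' x = f b - f a

namespace IsPrimitive

variable {f f' g g' : ℝ → ℝ}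

theorem intervalIntegrable (h : IsPrimitive f f') (a b : ℝ) :
    IntervalIntegrable f' volume a b :=
  (h.locallyIntegrable.integrableOn_isCompact isCompact_uIcc).intervalIntegrable

theorem of_locallyIntegrable (h : LocallyIntegrable f' volume) :
    IsPrimitive (fun x => ∫ t in (0 : ℝ)..x, f' t) f' := by
  have hint : ∀ a b, IntervalIntegrable f' volume a b := fun a b =>
    (h.integrableOn_isCompact isCompact_uIcc).intervalIntegrable
  exact ⟨h, fun a b => by
    rw [← intervalIntegral.integral_interval_sub_left (hint 0 b) (hint 0 a)]⟩

theorem of_hasDerivAt (h : ∀ x, HasDerivAt f (f' x) x) (hc : Continuous f') :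
    IsPrimitive f f' where
  locallyIntegrable := hc.locallyIntegrable
  integral_eq_sub a b :=
    intervalIntegral.integral_eq_sub_of_hasDerivAt (fun x _ => h x) (hc.intervalIntegrable a b)

theorem eq_add_integral (h : IsPrimitive f f') (a : ℝ) :
    f = fun x => f a + ∫ t in a..x, f' t := by
  ext x
  rw [h.integral_eq_sub]
  ring

theorem ae_hasDerivAt (h : IsPrimitive f f') : ∀ᵐ x, HasDerivAt f (f' x) x := by
  filter_upwards [LocallyIntegrable.ae_hasDerivAt_integral h.locallyIntegrable] with x hx
  rw [h.eq_add_integral 0]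
  exact (hx 0).const_add _

theorem continuous (h : IsPrimitive f f') : Continuous f := by
  rw [h.eq_add_integral 0]
  exact continuous_const.add
    (intervalIntegral.continuous_primitive (fun a b => h.intervalIntegrable a b) 0)

theorem absolutelyContinuousOnInterval (h : IsPrimitive f f') (a b : ℝ) :
    AbsolutelyContinuousOnInterval f a b := by
  have hconst : AbsolutelyContinuousOnInterval (fun _ : ℝ => f a) a b :=
    (contDiff_const (n := 1)).contDiffOn.absolutelyContinuousOnInterval
  have hint := (h.intervalIntegrable a b).absolutelyContinuousOnInterval_intervalIntegral
    (c := a) (by simp)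
  rw [h.eq_add_integral a]
  simpa [Pi.add_def] using hconst.add hint

theorem const (c : ℝ) : IsPrimitive (fun _ => c) (fun _ => 0) :=
  of_hasDerivAt (fun x => hasDerivAt_const x c) continuous_const

theorem add (hf : IsPrimitive f f') (hg : IsPrimitive g g') :
    IsPrimitive (fun x => f x + g x) (fun x => f' x + g' x) where
  locallyIntegrable := hf.locallyIntegrable.add hg.locallyIntegrable
  integral_eq_sub a b := by
    rw [intervalIntegral.integral_add (hf.intervalIntegrable a b) (hg.intervalIntegrable a b),
      hf.integral_eq_sub, hg.integral_eq_sub]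
    ring

theorem mul (hf : IsPrimitive f f') (hg : IsPrimitive g g') :
    IsPrimitive (fun x => f x * g x) (fun x => f' x * g x + f x * g' x) where
  locallyIntegrable := by
    refine LocallyIntegrable.add ?_ ?_
    · simpa only [smul_eq_mul, mul_comm] using hf.locallyIntegrable.smul_continuous hg.continuous
    · simpa only [smul_eq_mul] using hg.locallyIntegrable.continuous_smul hf.continuous
  integral_eq_sub a b := by
    rw [← (hf.absolutelyContinuousOnInterval a b).integral_deriv_mul_eq_sub
      (hg.absolutelyContinuousOnInterval a b)]
    refine intervalIntegral.integral_congr_ae ?_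
    filter_upwards [hf.ae_hasDerivAt, hg.ae_hasDerivAt] with x hfx hgx _
    rw [hfx.deriv, hgx.deriv]

theorem const_mul (hf : IsPrimitive f f') (c : ℝ) :
    IsPrimitive (fun x => c * f x) (fun x => c * f' x) := by
  simpa only [zero_mul, zero_add] using (const c).mul hf

theorem sub (hf : IsPrimitive f f') (hg : IsPrimitive g g') :
    IsPrimitive (fun x => f x - g x) (fun x => f' x - g' x) := by
  convert hf.add (hg.const_mul (-1)) using 2 <;> ring

theorem integrable_deriv_of_le {k : ℝ → ℝ} (h : IsPrimitive f f') (hf : Integrable f)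
    (hk : Integrable k) (hle : ∀ x, k x ≤ f' x) : Integrable f' := by
  obtain ⟨b, hb, hfb⟩ := exists_seq_tendsto_zero_atTop hf
  obtain ⟨a, ha, hfa⟩ := exists_seq_tendsto_zero_atBot hf
  suffices hint : Integrable fun x => f' x - k x by
    simpa [Pi.add_def] using hint.add hk
  refine (aecover_Ioc ha hb).integrable_of_integral_tendsto_of_nonneg_ae (0 - 0 - ∫ x, k x)
    (fun n => ((h.intervalIntegrable _ _).1.sub hk.integrableOn))
    (Eventually.of_forall fun x => sub_nonneg.2 (hle x)) ?_
  refine ((hfb.sub hfa).sub (intervalIntegral_tendsto_integral hk ha hb)).congr' ?_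
  filter_upwards [ha.eventually_le_atBot 0, hb.eventually_ge_atTop 0] with n han hbn
  rw [← intervalIntegral.integral_of_le (han.trans hbn),
    intervalIntegral.integral_sub (h.intervalIntegrable _ _) hk.intervalIntegrable,
    h.integral_eq_sub]

theorem integral_deriv_eq_zero (h : IsPrimitive f f') (hf : Integrable f)
    (hf' : Integrable f') : ∫ x, f' x = 0 := by
  obtain ⟨b, hb, hfb⟩ := exists_seq_tendsto_zero_atTop hf
  obtain ⟨a, ha, hfa⟩ := exists_seq_tendsto_zero_atBot hf
  refine tendsto_nhds_unique (intervalIntegral_tendsto_integral hf' ha hb) ?_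
  simpa only [h.integral_eq_sub, sub_zero] using hfb.sub hfa

theorem hasWeakDeriv (hf : IsPrimitive f f') : HasWeakDeriv f f' := by
  refine ⟨hf.continuous.locallyIntegrable, hf.locallyIntegrable, fun φ hφ hc => ?_⟩
  have hd : IsPrimitive φ (deriv φ) :=
    of_hasDerivAt (fun x => (hφ.differentiable (by simp) x).hasDerivAt)
      (hφ.continuous_deriv (by simp))
  have hint : Integrable fun x => f x * φ x :=
    (hf.continuous.mul hφ.continuous).integrable_of_hasCompactSupport hc.mul_left
  have hint₁ : Integrable fun x => f' x * φ x :=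
    hf.locallyIntegrable.integrable_smul_right_of_hasCompactSupport hφ.continuous hc
  have hint₂ : Integrable fun x => f x * deriv φ x :=
    (hf.continuous.mul (hφ.continuous_deriv (by simp))).integrable_of_hasCompactSupport
      hc.deriv.mul_left
  have h0 := (hf.mul hd).integral_deriv_eq_zero hint (hint₁.add hint₂)
  rw [integral_add hint₁ hint₂] at h0
  linarith

end IsPrimitive

theorem exists_deriv_eq_of_integral_eq_zero {θ : ℝ → ℝ} (hθ : ContDiff ℝ ∞ θ)
    (hc : HasCompactSupport θ) (h0 : ∫ x, θ x = 0) :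
    ∃ φ : ℝ → ℝ, ContDiff ℝ ∞ φ ∧ HasCompactSupport φ ∧ deriv φ = θ := by
  obtain ⟨R, hR⟩ : ∃ R : ℝ, ∀ x, R ≤ |x| → θ x = 0 := by
    obtain ⟨R, hR⟩ := hc.isBounded.subset_ball 0
    refine ⟨R, fun x hx => image_eq_zero_of_notMem_tsupport fun h => hx.not_gt ?_⟩
    simpa using hR h
  have hd : ∀ x, HasDerivAt (fun x => ∫ t in (-R)..x, θ t) (θ x) x := fun x =>
    (hθ.continuous.integral_hasStrictDerivAt _ _).hasDerivAt
  have hde : deriv (fun x => ∫ t in (-R)..x, θ t) = θ := funext fun x => (hd x).deriv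
  refine ⟨fun x => ∫ t in (-R)..x, θ t, ?_, ?_, hde⟩
  · rw [contDiff_infty_iff_deriv, hde]
    exact ⟨fun x => (hd x).differentiableAt, hθ⟩
  · refine HasCompactSupport.intro (isCompact_Icc (a := -R) (b := R)) fun x hx => ?_
    rcases lt_or_ge x (-R) with hlt | hge
    · refine intervalIntegral.integral_zero_ae (Eventually.of_forall fun t ht => hR t ?_)
      rw [uIoc_of_ge hlt.le] at ht
      exact le_abs.2 (.inr (le_neg_of_le_neg ht.2))
    · have hRx : R < x := lt_of_not_ge fun h => hx ⟨hge, h⟩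
      rw [intervalIntegral.integral_eq_integral_of_support_subset, h0]
      intro t ht
      have := abs_lt.1 (not_le.1 (mt (hR t) ht))
      exact ⟨this.1, (this.2.trans hRx).le⟩

/-- The du Bois-Reymond lemma. -/
theorem ae_eq_const_of_integral_mul_deriv_eq_zero {h : ℝ → ℝ} (hh : LocallyIntegrable h volume)
    (h0 : ∀ φ : ℝ → ℝ, ContDiff ℝ ∞ φ → HasCompactSupport φ → ∫ x, h x * deriv φ x = 0) :
    ∃ c : ℝ, ∀ᵐ x, h x = c := by
  let B : ContDiffBump (0 : ℝ) := default
  let χ : ℝ → ℝ := B.normed volume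
  have hχ : ContDiff ℝ ∞ χ := B.contDiff_normed
  have hχc : HasCompactSupport χ := B.hasCompactSupport_normed
  have hint : ∀ ψ : ℝ → ℝ, ContDiff ℝ ∞ ψ → HasCompactSupport ψ →
      Integrable ψ ∧ Integrable fun x => ψ x * h x := fun ψ hψ hc =>
    ⟨hψ.continuous.integrable_of_hasCompactSupport hc,
      hh.integrable_smul_left_of_hasCompactSupport hψ.continuous hc⟩
  refine ⟨∫ x, χ x * h x, ae_eq_of_integral_contDiff_smul_eq hh
    (locallyIntegrable_const _) fun ψ hψ hc => ?_⟩
  -- `ψ` and its mean times `χ` have the same integral, so they differ by a derivative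
  obtain ⟨φ, hφ, hφc, hφd⟩ := exists_deriv_eq_of_integral_eq_zero
    (θ := fun x => ψ x - (∫ y, ψ y) * χ x) (hψ.sub (contDiff_const.mul hχ))
    (hc.sub hχc.mul_left) (by
      rw [integral_sub (hint ψ hψ hc).1 ((hint χ hχ hχc).1.const_mul _), integral_const_mul,
        show ∫ x, χ x = 1 from B.integral_normed, mul_one, sub_self])
  have key := h0 φ hφ hφc
  have hsplit : (fun x => h x * (ψ x - (∫ y, ψ y) * χ x)) =
      fun x => ψ x * h x - (∫ y, ψ y) * (χ x * h x) := by
    ext x; ring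
  rw [hφd, hsplit, integral_sub (hint ψ hψ hc).2 ((hint χ hχ hχc).2.const_mul _),
    integral_const_mul] at key
  simp only [smul_eq_mul, integral_mul_const]
  linarith

theorem HasWeakDeriv.exists_isPrimitive {u w : ℝ → ℝ} (h : HasWeakDeriv u w) :
    ∃ v : ℝ → ℝ, v =ᵐ[volume] u ∧ IsPrimitive v w := by
  have hp := IsPrimitive.of_locallyIntegrable h.2.1
  have hw := hp.hasWeakDeriv
  obtain ⟨c, hc⟩ := ae_eq_const_of_integral_mul_deriv_eq_zero (h.1.sub hw.1) fun φ hφ hφc => by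
    have hint : ∀ {r : ℝ → ℝ}, LocallyIntegrable r volume →
        Integrable fun x => r x * deriv φ x := fun hr =>
      hr.integrable_smul_right_of_hasCompactSupport (hφ.continuous_deriv (by simp)) hφc.deriv
    simp only [Pi.sub_apply, sub_mul]
    rw [integral_sub (hint h.1) (hint hw.1), h.2.2 φ hφ hφc, hw.2.2 φ hφ hφc, sub_self]
  refine ⟨fun x => c + ∫ t in (0 : ℝ)..x, w t, ?_, ?_⟩
  · filter_upwards [hc] with x hx
    rw [Pi.sub_apply] at hx
    linarith
  · simpa only [zero_add] using (IsPrimitive.const c).add hp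

theorem HasWeakDeriv.congr {u v w : ℝ → ℝ} (h : HasWeakDeriv u w) (huv : u =ᵐ[volume] v) :
    HasWeakDeriv v w :=
  ⟨h.1.congr huv, h.2.1, fun φ hφ hc =>
    (integral_congr_ae (huv.symm.mul .rfl)).trans (h.2.2 φ hφ hc)⟩

theorem HasWeakDeriv.weakDeriv_ae_eq {u w : ℝ → ℝ} (h : HasWeakDeriv u w) :
    weakDeriv u =ᵐ[volume] w :=
  (hasWeakDeriv_weakDeriv ⟨w, h⟩).ae_eq h

/-! ### Hardy and Poincaré inequalities in `L¹` -/

theorem lintegral_setLIntegral_section {α β : Type*} [MeasurableSpace α] [MeasurableSpace β]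
    {μ : Measure α} {ν : Measure β} [SFinite μ] [SFinite ν] {K : α → Set β}
    (hK : MeasurableSet {p : α × β | p.2 ∈ K p.1}) {φ : β → ℝ≥0∞} (hφ : AEMeasurable φ ν) :
    ∫⁻ x, ∫⁻ t in K x, φ t ∂ν ∂μ = ∫⁻ t, φ t * μ {x | t ∈ K x} ∂ν := by
  have hKx : ∀ x, MeasurableSet (K x) := fun x => measurable_prodMk_left hK
  have hKt : ∀ t, MeasurableSet {x | t ∈ K x} := fun t => measurable_prodMk_right hK
  have hmeas : AEMeasurable (Function.uncurry fun x t => (K x).indicator φ t) (μ.prod ν) :=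
    (hφ.comp_snd (μ := μ)).indicator hK
  simp_rw [← lintegral_indicator (hKx _)]
  rw [lintegral_lintegral_swap hmeas]
  refine lintegral_congr fun t => ?_
  have hind : (fun x => (K x).indicator φ t) =
      fun x => φ t * {x | t ∈ K x}.indicator 1 x := by
    ext x
    by_cases hx : t ∈ K x <;> simp [hx]
  rw [hind, lintegral_const_mul _ (measurable_one.indicator (hKt t)),
    lintegral_indicator_one (hKt t)]

theorem measurableSet_snd_mem_uIoc : MeasurableSet {p : ℝ × ℝ | p.2 ∈ uIoc 0 p.1} :=
  (measurableSet_lt (measurable_const.min measurable_fst) measurable_snd).inter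
    (measurableSet_le measurable_snd (measurable_const.max measurable_fst))

namespace IsPrimitive

variable {f f' : ℝ → ℝ}

theorem enorm_sub_le (h : IsPrimitive f f') (a b : ℝ) :
    ‖f b - f a‖ₑ ≤ ∫⁻ t in uIoc a b, ‖f' t‖ₑ := by
  rw [← h.integral_eq_sub, ← ofReal_norm, intervalIntegral.norm_intervalIntegral_eq,
    ofReal_norm]
  exact enorm_integral_le_lintegral_enorm _

theorem tendsto_atTop_zero (h : IsPrimitive f f') (hf : Integrable f) (hf' : Integrable f') :
    Tendsto f atTop (𝓝 0) := by
  have hlim : Tendsto f atTop (𝓝 (f 0 + ∫ t in Ioi 0, f' t)) := by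
    rw [h.eq_add_integral 0]
    simpa using
      (intervalIntegral_tendsto_integral_Ioi 0 hf'.integrableOn tendsto_id).const_add (f 0)
  rwa [← IntegrableAtFilter.eq_zero_of_tendsto ⟨univ, univ_mem, hf.integrableOn⟩ ?_ hlim]
  intro s hs
  obtain ⟨a, ha⟩ := mem_atTop_sets.1 hs
  exact top_unique ((Real.volume_Ici (a := a)).ge.trans (measure_mono ha))

theorem tendsto_atBot_zero (h : IsPrimitive f f') (hf : Integrable f) (hf' : Integrable f') :
    Tendsto f atBot (𝓝 0) := by
  have hlim : Tendsto f atBot (𝓝 (f 0 - ∫ t in Iic 0, f' t)) := by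
    refine ((intervalIntegral_tendsto_integral_Iic 0 hf'.integrableOn tendsto_id).const_sub
      (f 0)).congr fun x => ?_
    rw [id, h.integral_eq_sub, sub_sub_cancel]
  rwa [← IntegrableAtFilter.eq_zero_of_tendsto ⟨univ, univ_mem, hf.integrableOn⟩ ?_ hlim]
  intro s hs
  obtain ⟨a, ha⟩ := mem_atBot_sets.1 hs
  exact top_unique ((Real.volume_Iic (a := a)).ge.trans (measure_mono ha))

/-- Hardy's inequality in `L¹`. -/
theorem lintegral_enorm_le (h : IsPrimitive f f') (htop : Tendsto f atTop (𝓝 0))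
    (hbot : Tendsto f atBot (𝓝 0)) : ∫⁻ x, ‖f x‖ₑ ≤ ∫⁻ x, ‖x * f' x‖ₑ := by
  have hpt : ∀ x, ‖f x‖ₑ ≤ ∫⁻ t in {t | x ∈ uIoc 0 t}, ‖f' t‖ₑ := fun x => by
    have hlim : ∀ {l : Filter ℝ} [l.NeBot], Tendsto f l (𝓝 0) →
        (∀ᶠ y in l, uIoc y x ≤ᵐ[volume] {t | x ∈ uIoc 0 t}) →
        ‖f x‖ₑ ≤ ∫⁻ t in {t | x ∈ uIoc 0 t}, ‖f' t‖ₑ := fun {l} _ hl hsub => by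
      have hlim : Tendsto (fun y => ‖f x - f y‖ₑ) l (𝓝 ‖f x‖ₑ) := by
        simpa using (hl.const_sub (f x)).enorm
      refine le_of_tendsto hlim ?_
      filter_upwards [hsub] with y hy
      exact (h.enorm_sub_le y x).trans (lintegral_mono_set' hy)
    rcases lt_or_ge 0 x with hx | hx
    · refine hlim htop ?_
      filter_upwards [eventually_ge_atTop x] with y hy
      rw [uIoc_of_ge hy]
      refine LE.le.eventuallyLE fun t ht => ?_
      exact mem_uIoc.2 (.inl ⟨hx, ht.1.le⟩)
    · refine hlim hbot ?_
      filter_upwards [eventually_le_atBot x] with y hy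
      rw [uIoc_of_le hy]
      refine Ioo_ae_eq_Ioc.symm.le.trans (LE.le.eventuallyLE fun t ht => ?_)
      exact mem_uIoc.2 (.inr ⟨ht.2, hx⟩)
  calc ∫⁻ x, ‖f x‖ₑ ≤ ∫⁻ x, ∫⁻ t in {t | x ∈ uIoc 0 t}, ‖f' t‖ₑ := lintegral_mono hpt
    _ = ∫⁻ t, ‖f' t‖ₑ * volume (uIoc 0 t) :=
      lintegral_setLIntegral_section (K := fun x => {t | x ∈ uIoc 0 t})
        (measurable_swap measurableSet_snd_mem_uIoc)
        h.locallyIntegrable.aestronglyMeasurable.enorm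
    _ = ∫⁻ x, ‖x * f' x‖ₑ := by
      refine lintegral_congr fun t => ?_
      rw [uIoc, Real.volume_Ioc, max_sub_min_eq_abs, sub_zero, enorm_mul, mul_comm,
        ← ofReal_norm t, Real.norm_eq_abs]

end IsPrimitive

instance : IsProbabilityMeasure γ := inferInstanceAs (IsProbabilityMeasure (gaussianReal 0 1))

theorem γ_eq_withDensity : γ = volume.withDensity fun x => ENNReal.ofReal (𝔤 x) :=
  gaussianReal_of_var_ne_zero 0 one_ne_zero

theorem hasSubgaussianMGF_id_γ : HasSubgaussianMGF id 1 γ where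
  integrable_exp_mul t := integrable_exp_mul_gaussianReal t
  mgf_le t := by
    have hmgf : mgf id γ t = _ := mgf_gaussianReal (μ := 0) (v := 1) Measure.map_id t
    simp [hmgf]

theorem γ_section_uIoc_le (t : ℝ) :
    γ {x | t ∈ uIoc 0 x} ≤ ENNReal.ofReal (√(2 * Real.pi) * 𝔤 t) := by
  have hdens : √(2 * Real.pi) * 𝔤 t = Real.exp (-|t| ^ 2 / (2 * (1 : NNReal))) := by
    rw [gaussianPDFReal, NNReal.coe_one, mul_one, mul_inv_cancel_left₀ (by positivity)]
    simp
  rw [hdens, ← ofReal_measureReal]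
  refine ENNReal.ofReal_le_ofReal ?_
  rcases le_or_gt t 0 with ht | ht
  · refine le_trans (measureReal_mono fun x hx => ?_)
      (hasSubgaussianMGF_id_γ.neg.measure_ge_le (abs_nonneg t))
    have hx : min 0 x < t := hx.1
    rw [min_lt_iff, or_iff_right ht.not_gt] at hx
    simpa [abs_of_nonpos ht] using hx.le
  · refine le_trans (measureReal_mono fun x hx => ?_)
      (hasSubgaussianMGF_id_γ.measure_ge_le (abs_nonneg t))
    have hx : t ≤ max 0 x := hx.2
    rw [le_max_iff, or_iff_right ht.not_ge] at hx
    simpa [abs_of_pos ht] using hx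

theorem lintegral_γ (φ : ℝ → ℝ≥0∞) : ∫⁻ x, φ x ∂γ = ∫⁻ x, ENNReal.ofReal (𝔤 x) * φ x := by
  rw [γ_eq_withDensity, lintegral_withDensity_eq_lintegral_mul_non_measurable]
  · rfl
  · exact (measurable_gaussianPDFReal 0 1).ennreal_ofReal
  · exact Eventually.of_forall fun x => ENNReal.ofReal_lt_top

namespace IsPrimitive

variable {f f' : ℝ → ℝ}

theorem lintegral_enorm_sub_γ_le (h : IsPrimitive f f') :
    ∫⁻ x, ‖f x - f 0‖ₑ ∂γ ≤ ENNReal.ofReal √(2 * Real.pi) * ∫⁻ x, ‖f' x‖ₑ ∂γ := by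
  have hf' : AEMeasurable (fun x => ‖f' x‖ₑ) :=
    h.locallyIntegrable.aestronglyMeasurable.enorm
  calc ∫⁻ x, ‖f x - f 0‖ₑ ∂γ ≤ ∫⁻ x, (∫⁻ t in uIoc 0 x, ‖f' t‖ₑ) ∂γ :=
        lintegral_mono fun x => h.enorm_sub_le 0 x
    _ = ∫⁻ t, ‖f' t‖ₑ * γ {x | t ∈ uIoc 0 x} :=
        lintegral_setLIntegral_section measurableSet_snd_mem_uIoc hf'
    _ ≤ ∫⁻ t, ENNReal.ofReal √(2 * Real.pi) * (ENNReal.ofReal (𝔤 t) * ‖f' t‖ₑ) := by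
        refine lintegral_mono fun t => (mul_le_mul_right (γ_section_uIoc_le t) _).trans_eq ?_
        rw [ENNReal.ofReal_mul (Real.sqrt_nonneg _)]
        ring
    _ = ENNReal.ofReal √(2 * Real.pi) * ∫⁻ x, ‖f' x‖ₑ ∂γ := by
        rw [lintegral_const_mul' _ _ ENNReal.ofReal_ne_top, lintegral_γ]

theorem integrable_γ (h : IsPrimitive f f') (hf' : Integrable f' γ) : Integrable f γ := by
  suffices hsub : Integrable (fun x => f x - f 0) γ by
    simpa [Pi.add_def] using hsub.add (integrable_const (f 0))
  refine ⟨(h.continuous.sub continuous_const).aestronglyMeasurable,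
    h.lintegral_enorm_sub_γ_le.trans_lt ?_⟩
  exact ENNReal.mul_lt_top ENNReal.ofReal_lt_top hf'.hasFiniteIntegral

/-- The `L¹` Poincaré inequality for the Gaussian measure. -/
theorem integral_abs_sub_mean_le (h : IsPrimitive f f') (hf' : Integrable f' γ) :
    ∫ x, |f x - ∫ y, f y ∂γ| ∂γ ≤ 2 * √(2 * Real.pi) * ∫ x, |f' x| ∂γ := by
  have hf := h.integrable_γ hf'
  have hsub : Integrable (fun x => f x - f 0) γ := hf.sub (integrable_const _)
  have hanchored : ∫ x, |f x - f 0| ∂γ ≤ √(2 * Real.pi) * ∫ x, |f' x| ∂γ := by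
    simp_rw [← Real.norm_eq_abs]
    rw [integral_norm_eq_lintegral_enorm hsub.1, integral_norm_eq_lintegral_enorm hf'.1,
      ← ENNReal.toReal_ofReal (Real.sqrt_nonneg (2 * Real.pi)), ← ENNReal.toReal_mul]
    exact ENNReal.toReal_mono (ENNReal.mul_ne_top ENNReal.ofReal_ne_top hf'.2.ne)
      h.lintegral_enorm_sub_γ_le
  have hmean : |(∫ y, f y ∂γ) - f 0| ≤ ∫ x, |f x - f 0| ∂γ := by
    have := abs_integral_le_integral_abs (f := fun x => f x - f 0) (μ := γ)
    rwa [integral_sub hf (integrable_const _), integral_const, probReal_univ, one_smul] at this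
  calc ∫ x, |f x - ∫ y, f y ∂γ| ∂γ
      ≤ ∫ x, (|f x - f 0| + |(∫ y, f y ∂γ) - f 0|) ∂γ := by
        refine integral_mono (hf.sub (integrable_const _)).abs
          (hsub.abs.add (integrable_const _)) fun x => ?_
        rw [abs_sub_comm (∫ y, f y ∂γ)]
        exact abs_sub_le _ _ _
    _ = (∫ x, |f x - f 0| ∂γ) + |(∫ y, f y ∂γ) - f 0| := by
        rw [integral_add hsub.abs (integrable_const _), integral_const, probReal_univ, one_smul]
    _ ≤ 2 * √(2 * Real.pi) * ∫ x, |f' x| ∂γ := by linarith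

end IsPrimitive

/-! ### Monotone transport -/

/-- `g` is a continuous and positive density of `μ` with respect to Lebesgue measure. -/
structure HasPosDensity (μ : Measure ℝ) (g : ℝ → ℝ) : Prop where
  continuous : Continuous g
  pos : ∀ x, 0 < g x
  eq_withDensity : μ = volume.withDensity fun x => ENNReal.ofReal (g x)

namespace HasPosDensity

variable {μ ν : Measure ℝ} [IsProbabilityMeasure μ] [IsProbabilityMeasure ν] {g k : ℝ → ℝ}

theorem cdf_eq_integral (h : HasPosDensity μ g) (x : ℝ) :
    cdf μ x = ∫ t in Iic x, g t := by
  rw [cdf_eq_real, measureReal_def, h.eq_withDensity, withDensity_apply _ measurableSet_Iic,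
    integral_eq_lintegral_of_nonneg_ae (Eventually.of_forall fun t => (h.pos t).le)
      h.continuous.aestronglyMeasurable]

theorem integrable (h : HasPosDensity μ g) : Integrable g := by
  refine ⟨h.continuous.aestronglyMeasurable, ?_⟩
  rw [hasFiniteIntegral_iff_ofReal (Eventually.of_forall fun t => (h.pos t).le)]
  have huniv := measure_lt_top μ univ
  rwa [h.eq_withDensity, withDensity_apply _ .univ, setLIntegral_univ] at huniv

theorem hasDerivAt_cdf (h : HasPosDensity μ g) (x : ℝ) : HasDerivAt (cdf μ) (g x) x := by
  have hcdf : ⇑(cdf μ) = fun y => cdf μ 0 + ∫ t in (0 : ℝ)..y, g t := by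
    ext y
    rw [h.cdf_eq_integral, h.cdf_eq_integral, ← intervalIntegral.integral_Iic_sub_Iic
      h.integrable.integrableOn h.integrable.integrableOn, add_sub_cancel]
  rw [hcdf]
  exact (h.continuous.integral_hasStrictDerivAt 0 x).hasDerivAt.const_add _

theorem strictMono_cdf (h : HasPosDensity μ g) : StrictMono (cdf μ) :=
  strictMono_of_deriv_pos fun x => by
    rw [(h.hasDerivAt_cdf x).deriv]
    exact h.pos x

theorem range_cdf (h : HasPosDensity μ g) : range (cdf μ) = Ioo 0 1 := by
  refine Subset.antisymm (range_subset_iff.2 fun x => ?_) fun y hy => ?_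
  · exact ⟨(cdf_nonneg μ (x - 1)).trans_lt (h.strictMono_cdf (sub_one_lt x)),
      (h.strictMono_cdf (lt_add_one x)).trans_le (cdf_le_one μ (x + 1))⟩
  · have hcont : Continuous (cdf μ) :=
      continuous_iff_continuousAt.2 fun x => (h.hasDerivAt_cdf x).continuousAt
    obtain ⟨a, ha⟩ := ((tendsto_cdf_atBot μ).eventually (gt_mem_nhds hy.1)).exists
    obtain ⟨b, hb⟩ := ((tendsto_cdf_atTop μ).eventually (lt_mem_nhds hy.2)).exists
    exact mem_range_of_exists_le_of_exists_ge hcont ⟨a, ha.le⟩ ⟨b, hb.le⟩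

theorem exists_orderIso_cdf_eq (hμ : HasPosDensity μ g) (hν : HasPosDensity ν k) :
    ∃ T : ℝ ≃o ℝ, ∀ x, cdf ν (T x) = cdf μ x := by
  have hrange : range (cdf μ) = range (cdf ν) := hμ.range_cdf.trans hν.range_cdf.symm
  choose T hT using fun x => hrange.subset (mem_range_self x)
  have hmono : StrictMono T := fun x y hxy => by
    rw [← hν.strictMono_cdf.lt_iff_lt, hT, hT]
    exact hμ.strictMono_cdf hxy
  have hsurj : Function.Surjective T := fun y => by
    obtain ⟨x, hx⟩ := hrange.superset (mem_range_self y)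
    exact ⟨x, hν.strictMono_cdf.injective ((hT x).trans hx)⟩
  exact ⟨hmono.orderIsoOfSurjective T hsurj, hT⟩

theorem measurePreserving_of_cdf_eq {T : ℝ ≃o ℝ} (hT : ∀ x, cdf ν (T x) = cdf μ x) :
    MeasurePreserving T μ ν := by
  have hmeas : Measurable T := T.continuous.measurable
  have := Measure.isProbabilityMeasure_map (μ := μ) hmeas.aemeasurable
  refine ⟨hmeas, Measure.eq_of_cdf _ _ ?_⟩
  ext y
  obtain ⟨x, rfl⟩ := T.surjective y
  rw [hT, cdf_eq_real, cdf_eq_real, map_measureReal_apply hmeas measurableSet_Iic,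
    T.preimage_Iic, T.symm_apply_apply]

theorem hasDerivAt_of_cdf_eq (hμ : HasPosDensity μ g) (hν : HasPosDensity ν k) {T : ℝ ≃o ℝ}
    (hT : ∀ x, cdf ν (T x) = cdf μ x) (x : ℝ) : HasDerivAt T (g x / k (T x)) x :=
  (hν.hasDerivAt_cdf (T x)).of_comp_left T.continuous.continuousAt (hμ.hasDerivAt_cdf x)
    (hν.pos _).ne' (Eventually.of_forall hT)

theorem exists_transport (hμ : HasPosDensity μ g) (hν : HasPosDensity ν k) :
    ∃ T : ℝ ≃o ℝ, MeasurePreserving T μ ν ∧ ∀ x, HasDerivAt T (g x / k (T x)) x := by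
  obtain ⟨T, hT⟩ := hμ.exists_orderIso_cdf_eq hν
  exact ⟨T, measurePreserving_of_cdf_eq hT, hμ.hasDerivAt_of_cdf_eq hν hT⟩

end HasPosDensity

theorem hasPosDensity_γ : HasPosDensity γ 𝔤 where
  continuous := by unfold gaussianPDFReal; fun_prop
  pos x := gaussianPDFReal_pos 0 1 x one_ne_zero
  eq_withDensity := γ_eq_withDensity

/-! ### Densities and the discrepancy -/

theorem HasPosDensity.integrable_iff {μ : Measure ℝ} {g φ : ℝ → ℝ} (h : HasPosDensity μ g) :
    Integrable φ μ ↔ Integrable fun x => φ x * g x := by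
  rw [h.eq_withDensity, integrable_withDensity_iff h.continuous.measurable.ennreal_ofReal
    (Eventually.of_forall fun x => ENNReal.ofReal_lt_top)]
  simp only [ENNReal.toReal_ofReal (h.pos _).le]

theorem HasPosDensity.integral_eq {μ : Measure ℝ} {g : ℝ → ℝ} (h : HasPosDensity μ g)
    (φ : ℝ → ℝ) : ∫ x, φ x ∂μ = ∫ x, φ x * g x := by
  rw [h.eq_withDensity, integral_withDensity_eq_integral_toReal_smul
    h.continuous.measurable.ennreal_ofReal
    (Eventually.of_forall fun x => ENNReal.ofReal_lt_top)]
  simp only [ENNReal.toReal_ofReal (h.pos _).le, smul_eq_mul, mul_comm]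

theorem hasDerivAt_gaussianPDFReal (x : ℝ) : HasDerivAt 𝔤 (-(x * 𝔤 x)) x := by
  have hexp : HasDerivAt (fun x : ℝ => -x ^ 2 / 2) (-x) x := by
    exact (((hasDerivAt_pow 2 x).neg).div_const 2).congr_deriv (by norm_num; ring)
  have hpdf : (𝔤 : ℝ → ℝ) = fun x => (√(2 * Real.pi))⁻¹ * Real.exp (-x ^ 2 / 2) := by
    ext x
    simp [gaussianPDFReal]
  rw [hpdf]
  exact (hexp.exp.const_mul (√(2 * Real.pi))⁻¹).congr_deriv (by ring)

theorem isPrimitive_gaussianPDFReal : IsPrimitive 𝔤 fun x => -(x * 𝔤 x) :=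
  .of_hasDerivAt hasDerivAt_gaussianPDFReal (continuous_id.mul hasPosDensity_γ.continuous).neg

theorem integrable_mul_gaussianPDFReal : Integrable fun x => -(x * 𝔤 x) :=
  (hasPosDensity_γ.integrable_iff.1
    ((memLp_id_gaussianReal' 1 (by simp)).integrable le_rfl)).neg

theorem log_gaussianPDFReal_div (x y : ℝ) : Real.log (𝔤 x / 𝔤 y) = (y ^ 2 - x ^ 2) / 2 := by
  have hratio : 𝔤 x / 𝔤 y = Real.exp ((y ^ 2 - x ^ 2) / 2) := by
    simp only [gaussianPDFReal, NNReal.coe_one, mul_one, sub_zero]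
    rw [mul_div_mul_left _ _ (by positivity), ← Real.exp_sub]
    ring_nf
  rw [hratio, Real.log_exp]

/-- A function with unit mean and vanishing first moment with respect to `μ`, the second moment
being finite. -/
structure IsCenteredDensity (μ : Measure ℝ) (f : ℝ → ℝ) : Prop where
  integrable : Integrable f μ
  integral_eq_one : ∫ x, f x ∂μ = 1
  integral_mul_eq_zero : ∫ x, x * f x ∂μ = 0
  integrable_sq_mul : Integrable (fun x => x ^ 2 * f x) μ

/-- A centered probability density with respect to `γ`, of finite second moment and finite Fisher
information, with a specified version `f'` of its derivative. -/
structure IsDensity (f f' : ℝ → ℝ) : Prop extends IsCenteredDensity γ f where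
  isPrimitive : IsPrimitive f f'
  nonneg : ∀ x, 0 ≤ f x
  deriv_eq_zero : ∀ x, f x = 0 → f' x = 0
  integrable_fisher : Integrable (fun x => f' x ^ 2 / f x) γ

/-- The deficit in the logarithmic Sobolev inequality, for a specified version `f'` of the
derivative of `f`. -/
noncomputable def lsDeficit (f f' : ℝ → ℝ) : ℝ :=
  1 / 2 * ∫ x, f' x ^ 2 / f x ∂γ - ∫ x, f x * Real.log (f x) ∂γ

/-- The measure with density `f` with respect to `γ`. -/
noncomputable def law (f : ℝ → ℝ) : Measure ℝ := γ.withDensity fun x => ENNReal.ofReal (f x)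

/-- `T` transports `law f` to `γ`, and its derivative is the one given by the change of variables
formula. -/
structure IsTransport (f : ℝ → ℝ) (T : ℝ ≃o ℝ) : Prop where
  measurePreserving : MeasurePreserving T (law f) γ
  hasDerivAt : ∀ x, HasDerivAt T (f x * 𝔤 x / 𝔤 (T x)) x

/-- The discrepancy `(log f)' + (T - id)` between the score and the displacement of the transport
map. It vanishes for all Gaussians with unit variance. -/
noncomputable def disc (f f' : ℝ → ℝ) (T : ℝ ≃o ℝ) (x : ℝ) : ℝ := f' x / f x + (T x - x)

/-- An everywhere positive density. Its law then has a monotone transport map to `γ` which is a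
diffeomorphism. -/
structure IsPosDensity (f f' : ℝ → ℝ) : Prop extends IsDensity f f' where
  pos : ∀ x, 0 < f x

namespace IsPosDensity

variable {f f' : ℝ → ℝ} (h : IsPosDensity f f')
include h

theorem isProbabilityMeasure_law : IsProbabilityMeasure (law f) where
  measure_univ := by
    rw [law, withDensity_apply _ .univ, setLIntegral_univ, ← ofReal_integral_eq_lintegral_ofReal
      h.integrable (Eventually.of_forall h.nonneg), h.integral_eq_one, ENNReal.ofReal_one]

theorem hasPosDensity_law : HasPosDensity (law f) fun x => f x * 𝔤 x where
  continuous := h.isPrimitive.continuous.mul hasPosDensity_γ.continuous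
  pos x := mul_pos (h.pos x) (hasPosDensity_γ.pos x)
  eq_withDensity := by
    rw [law, γ_eq_withDensity, ← withDensity_mul _
      hasPosDensity_γ.continuous.measurable.ennreal_ofReal
      h.isPrimitive.continuous.measurable.ennreal_ofReal]
    simp only [Pi.mul_def, ← ENNReal.ofReal_mul (hasPosDensity_γ.pos _).le, mul_comm (f _)]

theorem integrable_law_iff {φ : ℝ → ℝ} :
    Integrable φ (law f) ↔ Integrable (fun x => φ x * f x) γ := by
  simp only [h.hasPosDensity_law.integrable_iff, hasPosDensity_γ.integrable_iff, mul_assoc]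

theorem integral_law (φ : ℝ → ℝ) : ∫ x, φ x ∂(law f) = ∫ x, φ x * f x ∂γ := by
  simp only [h.hasPosDensity_law.integral_eq, hasPosDensity_γ.integral_eq, mul_assoc]

theorem exists_isTransport : ∃ T : ℝ ≃o ℝ, IsTransport f T := by
  have := h.isProbabilityMeasure_law
  obtain ⟨T, hT, hT'⟩ := h.hasPosDensity_law.exists_transport hasPosDensity_γ
  exact ⟨T, hT, hT'⟩

theorem aestronglyMeasurable_law {φ : ℝ → ℝ} (hφ : AEStronglyMeasurable φ volume) :
    AEStronglyMeasurable φ (law f) := by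
  rw [h.hasPosDensity_law.eq_withDensity]
  exact hφ.mono_ac (withDensity_absolutelyContinuous _ _)

theorem memLp_id : MemLp (fun x => x) 2 (law f) := by
  rw [memLp_two_iff_integrable_sq measurable_id'.aestronglyMeasurable]
  exact (h.integrable_law_iff).2 h.integrable_sq_mul

theorem memLp_score : MemLp (fun x => f' x / f x) 2 (law f) := by
  have hmeas : AEStronglyMeasurable (fun x => f' x / f x) volume :=
    h.isPrimitive.locallyIntegrable.aestronglyMeasurable.div₀
      h.isPrimitive.continuous.aestronglyMeasurable
  rw [memLp_two_iff_integrable_sq (h.aestronglyMeasurable_law hmeas), h.integrable_law_iff]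
  refine h.integrable_fisher.congr (Eventually.of_forall fun x => ?_)
  have := (h.pos x).ne'
  field_simp

theorem isPrimitive_lebesgueDensity :
    IsPrimitive (fun x => f x * 𝔤 x) fun x => (f' x / f x - x) * (f x * 𝔤 x) := by
  convert h.isPrimitive.mul isPrimitive_gaussianPDFReal using 2 with x
  have := (h.pos x).ne'
  field_simp
  ring

variable {T : ℝ ≃o ℝ} (hT : IsTransport f T)
include hT

omit h in
theorem memLp_transport : MemLp T 2 (law f) :=
  (memLp_id_gaussianReal' 2 (by simp)).comp_measurePreserving hT.measurePreserving

theorem memLp_displacement : MemLp (fun x => T x - x) 2 (law f) :=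
  (memLp_transport hT).sub (h.memLp_id)

theorem memLp_disc : MemLp (disc f f' T) 2 (law f) :=
  (h.memLp_score).add (h.memLp_displacement hT)

end IsPosDensity

theorem sub_one_le_mul_log {y : ℝ} (hy : 0 ≤ y) : y - 1 ≤ y * Real.log y := by
  have := Real.negMulLog_le_one_sub_self hy
  rw [Real.negMulLog] at this
  linarith

/-- The derivative of `f * 𝔤 * (T - id)`, the flux whose vanishing total divergence gives the
logarithmic Sobolev inequality. -/
noncomputable def fluxDeriv (f f' : ℝ → ℝ) (T : ℝ ≃o ℝ) (x : ℝ) : ℝ :=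
  (f' x / f x - x) * (f x * 𝔤 x) * (T x - x) +
    f x * 𝔤 x * (f x * 𝔤 x / 𝔤 (T x) - 1)

namespace IsPosDensity

variable {f f' : ℝ → ℝ} (h : IsPosDensity f f') {T : ℝ ≃o ℝ} (hT : IsTransport f T)
include h hT

theorem isPrimitive_transport : IsPrimitive T fun x => f x * 𝔤 x / 𝔤 (T x) :=
  .of_hasDerivAt hT.hasDerivAt <| h.hasPosDensity_law.continuous.div
    (hasPosDensity_γ.continuous.comp T.continuous) fun x => (hasPosDensity_γ.pos (T x)).ne'

theorem isPrimitive_flux :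
    IsPrimitive (fun x => f x * 𝔤 x * (T x - x)) (fluxDeriv f f' T) :=
  h.isPrimitive_lebesgueDensity.mul
    ((h.isPrimitive_transport hT).sub (.of_hasDerivAt hasDerivAt_id continuous_const))

omit hT in
theorem half_sq_disc_add_log_le (x : ℝ) :
    1 / 2 * disc f f' T x ^ 2 * (f x * 𝔤 x) + f x * Real.log (f x) * 𝔤 x ≤
      1 / 2 * (f' x ^ 2 / f x * 𝔤 x) + fluxDeriv f f' T x := by
  have hf := h.pos x
  have hg := hasPosDensity_γ.pos x
  have hgT := hasPosDensity_γ.pos (T x)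
  have hlog : Real.log (f x) + (T x ^ 2 - x ^ 2) / 2 ≤ f x * 𝔤 x / 𝔤 (T x) - 1 := by
    rw [← log_gaussianPDFReal_div, ← Real.log_mul hf.ne' (div_pos hg hgT).ne', ← mul_div_assoc]
    exact Real.log_le_sub_one_of_pos (div_pos (mul_pos hf hg) hgT)
  have hw := mul_le_mul_of_nonneg_left hlog (mul_pos hf hg).le
  have hfisher : f' x ^ 2 / f x * 𝔤 x = (f' x / f x) ^ 2 * (f x * 𝔤 x) := by
    field_simp
  rw [hfisher, disc, fluxDeriv]
  linear_combination hw

theorem integrable_flux : Integrable fun x => f x * 𝔤 x * (T x - x) := by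
  have := h.isProbabilityMeasure_law
  simpa only [mul_comm] using h.hasPosDensity_law.integrable_iff.1
    ((h.memLp_displacement hT).integrable one_le_two)

theorem integrable_fluxDeriv : Integrable (fluxDeriv f f' T) := by
  refine (h.isPrimitive_flux hT).integrable_deriv_of_le (h.integrable_flux hT)
    ((hasPosDensity_γ.integrable_iff.1 (h.integrable.sub (integrable_const 1))).sub
      ((hasPosDensity_γ.integrable_iff.1 h.integrable_fisher).const_mul (1 / 2))) fun x => ?_
  have hg := hasPosDensity_γ.pos x
  have hdisc : 0 ≤ 1 / 2 * disc f f' T x ^ 2 * (f x * 𝔤 x) :=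
    mul_nonneg (by positivity) (h.hasPosDensity_law.pos x).le
  have hlog := mul_le_mul_of_nonneg_right (sub_one_le_mul_log (h.nonneg x)) hg.le
  have := h.half_sq_disc_add_log_le (T := T) x
  simp only [Pi.sub_apply]
  linarith

theorem integrable_half_sq_disc :
    Integrable fun x => 1 / 2 * disc f f' T x ^ 2 * (f x * 𝔤 x) :=
  h.hasPosDensity_law.integrable_iff.1 ((h.memLp_disc hT).integrable_sq.const_mul _)

theorem integrable_mul_log_of_isTransport : Integrable (fun x => f x * Real.log (f x)) γ := by
  have hcont : Continuous fun x => f x * Real.log (f x) :=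
    Real.continuous_mul_log.comp h.isPrimitive.continuous
  rw [hasPosDensity_γ.integrable_iff]
  refine integrable_of_le_of_le (hcont.mul hasPosDensity_γ.continuous).aestronglyMeasurable
    (Eventually.of_forall fun x => mul_le_mul_of_nonneg_right (sub_one_le_mul_log (h.nonneg x))
      (hasPosDensity_γ.pos x).le)
    (Eventually.of_forall fun x => ?_)
    (hasPosDensity_γ.integrable_iff.1 (h.integrable.sub (integrable_const 1)))
    (((hasPosDensity_γ.integrable_iff.1 h.integrable_fisher).const_mul (1 / 2)).add
      (h.integrable_fluxDeriv hT))
  have hdisc : 0 ≤ 1 / 2 * disc f f' T x ^ 2 * (f x * 𝔤 x) :=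
    mul_nonneg (by positivity) (h.hasPosDensity_law.pos x).le
  exact (le_add_of_nonneg_left hdisc).trans (h.half_sq_disc_add_log_le x)

theorem half_integral_sq_disc_le :
    1 / 2 * ∫ x, disc f f' T x ^ 2 ∂(law f) ≤ lsDeficit f f' := by
  have hlog := hasPosDensity_γ.integrable_iff.1 (h.integrable_mul_log_of_isTransport hT)
  have hfisher := (hasPosDensity_γ.integrable_iff.1 h.integrable_fisher).const_mul (1 / 2)
  have hflux : ∫ x, fluxDeriv f f' T x = 0 :=
    (h.isPrimitive_flux hT).integral_deriv_eq_zero (h.integrable_flux hT)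
      (h.integrable_fluxDeriv hT)
  have hint := integral_mono ((h.integrable_half_sq_disc hT).add hlog)
    (hfisher.add (h.integrable_fluxDeriv hT)) h.half_sq_disc_add_log_le
  simp only [Pi.add_apply] at hint
  rw [integral_add (h.integrable_half_sq_disc hT) hlog,
    integral_add hfisher (h.integrable_fluxDeriv hT), hflux, add_zero] at hint
  rw [lsDeficit, h.hasPosDensity_law.integral_eq, hasPosDensity_γ.integral_eq,
    hasPosDensity_γ.integral_eq, ← integral_const_mul, ← integral_const_mul]
  simp only [← mul_assoc] at hint ⊢
  linarith

end IsPosDensity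

/-! ### Stability for positive densities -/

theorem integral_abs_mul_le_sqrt_mul_sqrt {α : Type*} [MeasurableSpace α] {μ : Measure α}
    {u v : α → ℝ} (hu : MemLp u 2 μ) (hv : MemLp v 2 μ) :
    ∫ x, |u x * v x| ∂μ ≤ √(∫ x, u x ^ 2 ∂μ) * √(∫ x, v x ^ 2 ∂μ) := by
  have htwo : ENNReal.ofReal 2 = 2 := by norm_num
  have hholder := integral_mul_norm_le_Lp_mul_Lq (f := u) (g := v) .two_two
    (htwo.symm ▸ hu) (htwo.symm ▸ hv)
  simpa only [Real.norm_eq_abs, ← abs_mul, Real.rpow_two, sq_abs, ← Real.sqrt_eq_rpow]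
    using hholder

theorem integral_abs_le_sqrt {α : Type*} [MeasurableSpace α] {μ : Measure α}
    [IsProbabilityMeasure μ] {u : α → ℝ} (hu : MemLp u 2 μ) :
    ∫ x, |u x| ∂μ ≤ √(∫ x, u x ^ 2 ∂μ) := by
  simpa using integral_abs_mul_le_sqrt_mul_sqrt hu (memLp_const 1)

/-- The constant in the stability estimate for centered densities of second moment `m`. -/
noncomputable def stabConst (m : ℝ) : ℝ := 1 + 2 * √(2 * Real.pi) * √m

theorem integral_sq_γ : ∫ x, x ^ 2 ∂γ = 1 := by
  have hvar : Var[fun x => x; γ] = (1 : NNReal) := variance_fun_id_gaussianReal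
  have hmean : ∫ x, x ∂γ = 0 := integral_id_gaussianReal
  rwa [variance_of_integral_eq_zero aemeasurable_id' hmean] at hvar

namespace IsTransport

variable {f : ℝ → ℝ} {T : ℝ ≃o ℝ} (hT : IsTransport f T)
include hT

theorem integral_comp (φ : ℝ → ℝ) : ∫ x, φ (T x) ∂(law f) = ∫ y, φ y ∂γ :=
  hT.measurePreserving.integral_comp T.toHomeomorph.measurableEmbedding φ

theorem integrable_comp_iff {φ : ℝ → ℝ} :
    Integrable (fun x => φ (T x)) (law f) ↔ Integrable φ γ :=
  hT.measurePreserving.integrable_comp_emb T.toHomeomorph.measurableEmbedding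

end IsTransport

namespace IsPosDensity

variable {f f' : ℝ → ℝ} (h : IsPosDensity f f') {T : ℝ ≃o ℝ} (hT : IsTransport f T)
include h hT

/-- This difference of densities is the numerator of `1 - 1 / T'`, and its derivative only involves
the discrepancy: the terms `x * f x * 𝔤 x` and `T x * f x * 𝔤 x` combine to the displacement. -/
theorem isPrimitive_gap :
    IsPrimitive (fun x => f x * 𝔤 x - 𝔤 (T x)) fun x => disc f f' T x * (f x * 𝔤 x) := by
  have hcomp : IsPrimitive (fun x => 𝔤 (T x)) fun x => -(T x * (f x * 𝔤 x)) := by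
    refine .of_hasDerivAt (fun x => ?_) (T.continuous.mul h.hasPosDensity_law.continuous).neg
    refine ((hasDerivAt_gaussianPDFReal (T x)).comp x (hT.hasDerivAt x)).congr_deriv ?_
    have := (hasPosDensity_γ.pos (T x)).ne'
    field_simp
  convert h.isPrimitive_lebesgueDensity.sub hcomp using 2 with x
  rw [disc]
  ring

omit hT in
theorem integrable_lebesgueDensity_deriv :
    Integrable fun x => (f' x / f x - x) * (f x * 𝔤 x) := by
  have := h.isProbabilityMeasure_law
  exact h.hasPosDensity_law.integrable_iff.1 ((h.memLp_score.sub h.memLp_id).integrable one_le_two)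

omit hT in
theorem integrable_lebesgueDensity : Integrable fun x => f x * 𝔤 x :=
  hasPosDensity_γ.integrable_iff.1 h.integrable

omit hT in
theorem tendsto_gap_atTop : Tendsto (fun x => f x * 𝔤 x - 𝔤 (T x)) atTop (𝓝 0) := by
  simpa only [sub_zero, Function.comp_apply] using
    (h.isPrimitive_lebesgueDensity.tendsto_atTop_zero h.integrable_lebesgueDensity
      h.integrable_lebesgueDensity_deriv).sub
    ((isPrimitive_gaussianPDFReal.tendsto_atTop_zero hasPosDensity_γ.integrable
      integrable_mul_gaussianPDFReal).comp T.tendsto_atTop)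

omit hT in
theorem tendsto_gap_atBot : Tendsto (fun x => f x * 𝔤 x - 𝔤 (T x)) atBot (𝓝 0) := by
  simpa only [sub_zero, Function.comp_apply] using
    (h.isPrimitive_lebesgueDensity.tendsto_atBot_zero h.integrable_lebesgueDensity
      h.integrable_lebesgueDensity_deriv).sub
    ((isPrimitive_gaussianPDFReal.tendsto_atBot_zero hasPosDensity_γ.integrable
      integrable_mul_gaussianPDFReal).comp T.tendsto_atBot)

theorem lintegral_enorm_gap_le :
    ∫⁻ x, ‖f x * 𝔤 x - 𝔤 (T x)‖ₑ ≤ ∫⁻ x, ‖x * disc f f' T x * (f x * 𝔤 x)‖ₑ := by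
  simpa only [mul_assoc] using
    (h.isPrimitive_gap hT).lintegral_enorm_le h.tendsto_gap_atTop h.tendsto_gap_atBot

theorem integrable_mul_disc : Integrable (fun x => x * disc f f' T x) (law f) :=
  h.memLp_id.integrable_mul (h.memLp_disc hT)

theorem integrable_gap : Integrable fun x => f x * 𝔤 x - 𝔤 (T x) :=
  ⟨(h.isPrimitive_gap hT).continuous.aestronglyMeasurable, (h.lintegral_enorm_gap_le hT).trans_lt
    (h.hasPosDensity_law.integrable_iff.1 (h.integrable_mul_disc hT)).2⟩

theorem integral_abs_gap_le : ∫ x, |f x * 𝔤 x - 𝔤 (T x)| ≤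
    √(∫ x, x ^ 2 * f x ∂γ) * √(∫ x, disc f f' T x ^ 2 ∂(law f)) := by
  have hint := h.hasPosDensity_law.integrable_iff.1 (h.integrable_mul_disc hT)
  calc ∫ x, |f x * 𝔤 x - 𝔤 (T x)| ≤ ∫ x, |x * disc f f' T x * (f x * 𝔤 x)| := by
        simp_rw [← Real.norm_eq_abs]
        rw [integral_norm_eq_lintegral_enorm (h.integrable_gap hT).1,
          integral_norm_eq_lintegral_enorm hint.1]
        exact ENNReal.toReal_mono hint.2.ne (h.lintegral_enorm_gap_le hT)
    _ = ∫ x, |x * disc f f' T x| ∂(law f) := by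
        simp_rw [h.hasPosDensity_law.integral_eq, abs_mul _ (f _ * 𝔤 _),
          abs_of_pos (h.hasPosDensity_law.pos _)]
    _ ≤ √(∫ x, x ^ 2 * f x ∂γ) * √(∫ x, disc f f' T x ^ 2 ∂(law f)) := by
        rw [← h.integral_law]
        exact integral_abs_mul_le_sqrt_mul_sqrt h.memLp_id (h.memLp_disc hT)

theorem isPrimitive_inverse_displacement :
    IsPrimitive (fun y => y - T.symm y) fun y => 1 - 𝔤 y / (f (T.symm y) * 𝔤 (T.symm y)) := by
  have hw := h.hasPosDensity_law
  refine .of_hasDerivAt (fun y => ?_) (continuous_const.sub (hasPosDensity_γ.continuous.div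
    (hw.continuous.comp T.symm.continuous) fun y => (hw.pos (T.symm y)).ne'))
  have hT' := hT.hasDerivAt (T.symm y)
  rw [T.apply_symm_apply] at hT'
  have hsymm := hT'.of_local_left_inverse T.symm.continuous.continuousAt
    (div_pos (hw.pos _) (hasPosDensity_γ.pos y)).ne' (Eventually.of_forall T.apply_symm_apply)
  rw [inv_div] at hsymm
  exact (hasDerivAt_id y).sub hsymm

omit hT in
theorem inverse_displacement_deriv_mul (x : ℝ) :
    (1 - 𝔤 (T x) / (f (T.symm (T x)) * 𝔤 (T.symm (T x)))) * (f x * 𝔤 x) =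
      f x * 𝔤 x - 𝔤 (T x) := by
  rw [T.symm_apply_apply, sub_mul, one_mul, div_mul_cancel₀ _ (h.hasPosDensity_law.pos x).ne']

theorem integrable_inverse_displacement_deriv :
    Integrable (fun y => 1 - 𝔤 y / (f (T.symm y) * 𝔤 (T.symm y))) γ := by
  rw [← hT.integrable_comp_iff, h.hasPosDensity_law.integrable_iff]
  simp_rw [h.inverse_displacement_deriv_mul]
  exact h.integrable_gap hT

theorem integral_abs_inverse_displacement_deriv :
    ∫ y, |1 - 𝔤 y / (f (T.symm y) * 𝔤 (T.symm y))| ∂γ = ∫ x, |f x * 𝔤 x - 𝔤 (T x)| := by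
  rw [← hT.integral_comp, h.hasPosDensity_law.integral_eq]
  refine integral_congr_ae (Eventually.of_forall fun x => ?_)
  dsimp only
  rw [← h.inverse_displacement_deriv_mul, abs_mul, abs_of_pos (h.hasPosDensity_law.pos x)]

theorem integral_inverse_displacement : ∫ y, (y - T.symm y) ∂γ = 0 := by
  have := h.isProbabilityMeasure_law
  have htransport : ∫ x, T x ∂(law f) = 0 :=
    (hT.integral_comp fun y => y).trans integral_id_gaussianReal
  have hid : ∫ x, x ∂(law f) = 0 := (h.integral_law fun x => x).trans h.integral_mul_eq_zero
  rw [← hT.integral_comp]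
  simp_rw [T.symm_apply_apply]
  rw [integral_sub ((memLp_transport hT).integrable one_le_two)
    (h.memLp_id.integrable one_le_two), htransport, hid, sub_zero]

theorem integral_abs_displacement_le : ∫ x, |T x - x| ∂(law f) ≤
    2 * √(2 * Real.pi) * (√(∫ x, x ^ 2 * f x ∂γ) * √(∫ x, disc f f' T x ^ 2 ∂(law f))) := by
  calc ∫ x, |T x - x| ∂(law f)
      = ∫ y, |y - T.symm y - ∫ z, (z - T.symm z) ∂γ| ∂γ := by
        rw [h.integral_inverse_displacement hT, ← hT.integral_comp]
        simp only [T.symm_apply_apply, sub_zero]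
    _ ≤ 2 * √(2 * Real.pi) * ∫ y, |1 - 𝔤 y / (f (T.symm y) * 𝔤 (T.symm y))| ∂γ :=
        (h.isPrimitive_inverse_displacement hT).integral_abs_sub_mean_le
          (h.integrable_inverse_displacement_deriv hT)
    _ ≤ _ := by
        rw [h.integral_abs_inverse_displacement_deriv hT]
        exact mul_le_mul_of_nonneg_left (h.integral_abs_gap_le hT) (by positivity)

theorem lsDeficit_nonneg_of_isTransport : 0 ≤ lsDeficit f f' :=
  (mul_nonneg one_half_pos.le (integral_nonneg fun x => sq_nonneg (disc f f' T x))).trans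
    (h.half_integral_sq_disc_le hT)

theorem integral_abs_deriv_le_of_isTransport : ∫ x, |f' x| ∂γ ≤
    stabConst (∫ x, x ^ 2 * f x ∂γ) * √(2 * lsDeficit f f') := by
  have := h.isProbabilityMeasure_law
  have hdisc := h.memLp_disc hT
  have hdisp := h.memLp_displacement hT
  have hscore : ∫ x, |f' x| ∂γ = ∫ x, |disc f f' T x - (T x - x)| ∂(law f) := by
    rw [h.integral_law]
    refine integral_congr_ae (Eventually.of_forall fun x => ?_)
    have hx := h.pos x
    simp only [disc, add_sub_cancel_right, abs_div, abs_of_pos hx]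
    rw [div_mul_cancel₀ _ hx.ne']
  have hsqrt : √(∫ x, disc f f' T x ^ 2 ∂(law f)) ≤ √(2 * lsDeficit f f') :=
    Real.sqrt_le_sqrt (by linarith [h.half_integral_sq_disc_le hT])
  calc ∫ x, |f' x| ∂γ ≤ ∫ x, (|disc f f' T x| + |T x - x|) ∂(law f) := by
        rw [hscore]
        exact integral_mono ((hdisc.sub hdisp).integrable one_le_two).abs
          ((hdisc.integrable one_le_two).abs.add (hdisp.integrable one_le_two).abs)
          fun x => abs_sub _ _
    _ = ∫ x, |disc f f' T x| ∂(law f) + ∫ x, |T x - x| ∂(law f) :=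
        integral_add (hdisc.integrable one_le_two).abs (hdisp.integrable one_le_two).abs
    _ ≤ stabConst (∫ x, x ^ 2 * f x ∂γ) * √(∫ x, disc f f' T x ^ 2 ∂(law f)) := by
        rw [stabConst]
        linarith [integral_abs_le_sqrt hdisc, h.integral_abs_displacement_le hT]
    _ ≤ _ := mul_le_mul_of_nonneg_left hsqrt (by unfold stabConst; positivity)

theorem integral_sq_displacement_le :
    ∫ x, (T x - x) ^ 2 ∂(law f) ≤ 2 * (1 + ∫ x, x ^ 2 * f x ∂γ) := by
  have htransport : ∫ x, T x ^ 2 ∂(law f) = 1 :=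
    (hT.integral_comp fun y => y ^ 2).trans integral_sq_γ
  have hT2 := (memLp_transport hT).integrable_sq
  have hid2 := h.memLp_id.integrable_sq
  rw [← htransport, ← h.integral_law, ← integral_add hT2 hid2, ← integral_const_mul]
  refine integral_mono (h.memLp_displacement hT).integrable_sq ((hT2.add hid2).const_mul 2)
    fun x => ?_
  linarith [sq_nonneg (T x + x)]

theorem integral_mul_log_le_of_isTransport : ∫ x, f x * Real.log (f x) ∂γ ≤
    lsDeficit f f' + 2 * (1 + ∫ x, x ^ 2 * f x ∂γ) := by
  have hdisc := (h.memLp_disc hT).integrable_sq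
  have hdisp := (h.memLp_displacement hT).integrable_sq
  have hfisher : ∫ x, (f' x / f x) ^ 2 ∂(law f) = ∫ x, f' x ^ 2 / f x ∂γ := by
    rw [h.integral_law]
    refine integral_congr_ae (Eventually.of_forall fun x => ?_)
    have := (h.pos x).ne'
    field_simp
  have hscore : ∫ x, (f' x / f x) ^ 2 ∂(law f) ≤
      2 * (∫ x, disc f f' T x ^ 2 ∂(law f) + ∫ x, (T x - x) ^ 2 ∂(law f)) := by
    rw [← integral_add hdisc hdisp, ← integral_const_mul]
    refine integral_mono h.memLp_score.integrable_sq ((hdisc.add hdisp).const_mul 2) fun x => ?_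
    simp only [disc]
    linarith [sq_nonneg (f' x / f x + 2 * (T x - x))]
  have hlsi := h.half_integral_sq_disc_le hT
  have hdef : lsDeficit f f' =
    1 / 2 * ∫ x, f' x ^ 2 / f x ∂γ - ∫ x, f x * Real.log (f x) ∂γ := rfl
  linarith [h.integral_sq_displacement_le hT]

end IsPosDensity

/-! ### Removing positivity -/

theorem mul_log_add_mul_log_le {a b : ℝ} (ha : 0 ≤ a) (hb : 0 < b) :
    a * Real.log a + b * Real.log b ≤ (a + b) * Real.log (a + b) := by
  have hlog : a * Real.log a ≤ a * Real.log (a + b) := by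
    rcases ha.eq_or_lt with rfl | ha
    · simp
    exact mul_le_mul_of_nonneg_left (Real.log_le_log ha (by linarith)) ha.le
  linarith [mul_le_mul_of_nonneg_left (Real.log_le_log hb (by linarith : b ≤ a + b)) hb.le]

theorem le_of_forall_pos_le {a : ℝ} {b : ℝ → ℝ} (hb : ContinuousAt b 0)
    (h : ∀ t, 0 < t → a ≤ b t) : a ≤ b 0 :=
  ge_of_tendsto (hb.tendsto.mono_left (nhdsWithin_le_nhds (s := Ioi 0))) (by
    filter_upwards [self_mem_nhdsWithin] with t ht using h t ht)

theorem γ_absolutelyContinuous : γ ≪ volume := gaussianReal_absolutelyContinuous 0 one_ne_zero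

theorem integrable_sq_γ : Integrable (fun x => x ^ 2) γ :=
  (memLp_id_gaussianReal' 2 (by simp)).integrable_sq

/-- The mixture of the density `f` and the constant density `1` with weights proportional to `1`
and `t`. -/
noncomputable def mix (t : ℝ) (f : ℝ → ℝ) (x : ℝ) : ℝ := (1 + t)⁻¹ * (f x + t)

/-- An upper bound for the deficit of `mix t f`, where `d` is the deficit of `f`. -/
noncomputable def mixBound (d t : ℝ) : ℝ :=
  (1 + t)⁻¹ * (d - t * Real.log t) + Real.log (1 + t)

theorem continuousAt_mixBound (d : ℝ) : ContinuousAt (mixBound d) 0 := by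
  have hmul_log : ContinuousAt (fun t => t * Real.log t) 0 :=
    Real.continuous_mul_log.continuousAt
  unfold mixBound
  fun_prop (disch := simp)

theorem mixBound_zero (d : ℝ) : mixBound d 0 = d := by simp [mixBound]

theorem integral_mul_mix {f φ : ℝ → ℝ} {t : ℝ} (hf : Integrable (fun x => φ x * f x) γ)
    (hφ : Integrable φ γ) :
    ∫ x, φ x * mix t f x ∂γ = (1 + t)⁻¹ * (∫ x, φ x * f x ∂γ + t * ∫ x, φ x ∂γ) := by
  have hsplit : ∀ x, φ x * mix t f x = (1 + t)⁻¹ * (φ x * f x + t * φ x) := fun x => by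
    rw [mix]
    ring
  simp_rw [hsplit]
  rw [integral_const_mul, integral_add hf (hφ.const_mul t), integral_const_mul]

theorem IsCenteredDensity.integrable_mul {μ : Measure ℝ} {f : ℝ → ℝ}
    (h : IsCenteredDensity μ f) : Integrable (fun x => x * f x) μ := by
  refine (h.integrable.abs.add h.integrable_sq_mul.abs).mono'
    (aestronglyMeasurable_id.mul h.integrable.1) (Eventually.of_forall fun x => ?_)
  simp only [Pi.add_apply, Real.norm_eq_abs, abs_mul, abs_pow]
  nlinarith [mul_nonneg (abs_nonneg (f x)) (sq_nonneg (|x| - 1)),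
    mul_nonneg (abs_nonneg (f x)) (sq_nonneg |x|), abs_nonneg (f x)]

namespace IsDensity

variable {f f' : ℝ → ℝ} (h : IsDensity f f') {t : ℝ} (ht : 0 < t)
include h ht

theorem mix_pos (x : ℝ) : 0 < mix t f x :=
  mul_pos (by positivity) (add_pos_of_nonneg_of_pos (h.nonneg x) ht)

omit ht in
theorem isPrimitive_mix : IsPrimitive (mix t f) fun x => (1 + t)⁻¹ * f' x := by
  change IsPrimitive (fun x => (1 + t)⁻¹ * (f x + t)) _
  simpa only [add_zero] using (h.isPrimitive.add (.const t)).const_mul (1 + t)⁻¹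

theorem fisher_mix_le (x : ℝ) :
    ((1 + t)⁻¹ * f' x) ^ 2 / mix t f x ≤ (1 + t)⁻¹ * (f' x ^ 2 / f x) := by
  have hsplit : ((1 + t)⁻¹ * f' x) ^ 2 / mix t f x = (1 + t)⁻¹ * (f' x ^ 2 / (f x + t)) := by
    rw [mix]
    field_simp
  rw [hsplit]
  refine mul_le_mul_of_nonneg_left ?_ (by positivity)
  rcases (h.nonneg x).eq_or_lt with hzero | hpos
  · simp [h.deriv_eq_zero x hzero.symm]
  · exact div_le_div_of_nonneg_left (sq_nonneg _) hpos (by linarith)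

theorem isCenteredDensity_mix : IsCenteredDensity γ (mix t f) where
  integrable := (h.integrable.add (integrable_const t)).const_mul _
  integral_eq_one := by
    have hone := integral_mul_mix (φ := fun _ => 1) (t := t) (by simpa using h.integrable)
      (integrable_const _)
    simp only [one_mul, h.integral_eq_one, integral_const, probReal_univ, one_smul, mul_one]
      at hone
    rw [hone, inv_mul_cancel₀ (by positivity)]
  integral_mul_eq_zero := by
    rw [integral_mul_mix h.integrable_mul ((memLp_id_gaussianReal' 1 (by simp)).integrable le_rfl),
      h.integral_mul_eq_zero, show ∫ x, x ∂γ = 0 from integral_id_gaussianReal, mul_zero,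
      add_zero, mul_zero]
  integrable_sq_mul := by
    refine ((h.integrable_sq_mul.add (integrable_sq_γ.const_mul t)).const_mul (1 + t)⁻¹).congr
      (Eventually.of_forall fun x => ?_)
    simp only [mix, Pi.add_apply]
    ring

theorem isPosDensity_mix : IsPosDensity (mix t f) fun x => (1 + t)⁻¹ * f' x where
  toIsCenteredDensity := h.isCenteredDensity_mix ht
  isPrimitive := h.isPrimitive_mix
  nonneg x := (h.mix_pos ht x).le
  deriv_eq_zero x hx := absurd hx (h.mix_pos ht x).ne'
  integrable_fisher := by
    refine (h.integrable_fisher.const_mul (1 + t)⁻¹).mono' ?_ (Eventually.of_forall fun x => ?_)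
    · have hg := h.isPrimitive_mix (t := t)
      exact ((hg.locallyIntegrable.aestronglyMeasurable.pow 2).div₀
        hg.continuous.aestronglyMeasurable).mono_ac γ_absolutelyContinuous
    · rw [Real.norm_of_nonneg (div_nonneg (sq_nonneg _) (h.mix_pos ht x).le)]
      exact h.fisher_mix_le ht x
  pos := h.mix_pos ht

omit ht in
theorem integral_sq_mul_mix :
    ∫ x, x ^ 2 * mix t f x ∂γ = (1 + t)⁻¹ * (∫ x, x ^ 2 * f x ∂γ + t) := by
  rw [integral_mul_mix h.integrable_sq_mul integrable_sq_γ, integral_sq_γ, mul_one]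

theorem add_mul_log_add (x : ℝ) : (f x + t) * Real.log (f x + t) =
    (1 + t) * (mix t f x * Real.log (mix t f x) + Real.log (1 + t) * mix t f x) := by
  have hadd : f x + t = (1 + t) * mix t f x := by
    rw [mix, mul_inv_cancel_left₀ (by positivity)]
  rw [hadd, Real.log_mul (by positivity) (h.mix_pos ht x).ne']
  ring

theorem integrable_mix_mul_log : Integrable (fun x => mix t f x * Real.log (mix t f x)) γ :=
  have hmix := h.isPosDensity_mix ht
  let ⟨_, hT⟩ := hmix.exists_isTransport
  hmix.integrable_mul_log_of_isTransport hT

theorem integrable_add_mul_log_add :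
    Integrable (fun x => (f x + t) * Real.log (f x + t)) γ := by
  simp_rw [h.add_mul_log_add ht]
  exact ((h.integrable_mix_mul_log ht).add
    ((h.isCenteredDensity_mix ht).integrable.const_mul _)).const_mul _

theorem integral_add_mul_log_add : ∫ x, (f x + t) * Real.log (f x + t) ∂γ =
    (1 + t) * (∫ x, mix t f x * Real.log (mix t f x) ∂γ + Real.log (1 + t)) := by
  have hmix := h.isCenteredDensity_mix ht
  simp_rw [h.add_mul_log_add ht]
  rw [integral_const_mul, integral_add (h.integrable_mix_mul_log ht) (hmix.integrable.const_mul _),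
    integral_const_mul, hmix.integral_eq_one, mul_one]

omit ht in
theorem integrable_mul_log : Integrable (fun x => f x * Real.log (f x)) γ := by
  refine integrable_of_le_of_le (Real.continuous_mul_log.comp
      h.isPrimitive.continuous).aestronglyMeasurable
    (Eventually.of_forall fun x => sub_one_le_mul_log (h.nonneg x))
    (Eventually.of_forall fun x => ?_)
    (h.integrable.sub (integrable_const 1)) (h.integrable_add_mul_log_add one_pos)
  simpa using mul_log_add_mul_log_le (h.nonneg x) one_pos

theorem integral_mul_log_add_le : ∫ x, f x * Real.log (f x) ∂γ + t * Real.log t ≤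
    (1 + t) * (∫ x, mix t f x * Real.log (mix t f x) ∂γ + Real.log (1 + t)) := by
  rw [← h.integral_add_mul_log_add ht]
  have hint := integral_mono (h.integrable_mul_log.add (integrable_const (t * Real.log t)))
    (h.integrable_add_mul_log_add ht) fun x => mul_log_add_mul_log_le (h.nonneg x) ht
  simp only [Pi.add_apply] at hint
  rwa [integral_add h.integrable_mul_log (integrable_const _), integral_const, probReal_univ,
    one_smul] at hint

theorem lsDeficit_mix_le :
    lsDeficit (mix t f) (fun x => (1 + t)⁻¹ * f' x) ≤ mixBound (lsDeficit f f') t := by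
  have hfisher := integral_mono (h.isPosDensity_mix ht).integrable_fisher
    (h.integrable_fisher.const_mul (1 + t)⁻¹) (h.fisher_mix_le ht)
  rw [integral_const_mul] at hfisher
  have hlog := mul_le_mul_of_nonneg_left (h.integral_mul_log_add_le ht)
    (by positivity : 0 ≤ (1 + t)⁻¹)
  rw [inv_mul_cancel_left₀ (by positivity)] at hlog
  rw [lsDeficit, mixBound, lsDeficit]
  linarith

omit ht in
theorem lsDeficit_nonneg : 0 ≤ lsDeficit f f' := by
  rw [← mixBound_zero (lsDeficit f f')]
  refine le_of_forall_pos_le (continuousAt_mixBound _) fun t ht => ?_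
  obtain ⟨T, hT⟩ := (h.isPosDensity_mix ht).exists_isTransport
  exact ((h.isPosDensity_mix ht).lsDeficit_nonneg_of_isTransport hT).trans (h.lsDeficit_mix_le ht)

omit ht in
theorem integral_mul_log_le : ∫ x, f x * Real.log (f x) ∂γ ≤
    lsDeficit f f' + 2 * (1 + ∫ x, x ^ 2 * f x ∂γ) := by
  set m := ∫ x, x ^ 2 * f x ∂γ with hm
  suffices hlim : ∀ t, 0 < t → ∫ x, f x * Real.log (f x) ∂γ ≤
      (1 + t) * (mixBound (lsDeficit f f') t + 2 * (1 + (1 + t)⁻¹ * (m + t)) +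
        Real.log (1 + t)) - t * Real.log t by
    refine (le_of_forall_pos_le ?_ hlim).trans_eq (by simp [mixBound_zero])
    have := continuousAt_mixBound (lsDeficit f f')
    have hmul_log : ContinuousAt (fun t => t * Real.log t) 0 :=
      Real.continuous_mul_log.continuousAt
    fun_prop (disch := simp)
  intro t ht
  obtain ⟨T, hT⟩ := (h.isPosDensity_mix ht).exists_isTransport
  have hmix := (h.isPosDensity_mix ht).integral_mul_log_le_of_isTransport hT
  rw [h.integral_sq_mul_mix, ← hm] at hmix
  have hbound := mul_le_mul_of_nonneg_left
    (add_le_add_left (hmix.trans (add_le_add_left (h.lsDeficit_mix_le ht) _)) (Real.log (1 + t)))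
    (by positivity : 0 ≤ 1 + t)
  linarith [h.integral_mul_log_add_le ht]

omit ht in
theorem integral_abs_deriv_le : ∫ x, |f' x| ∂γ ≤
    stabConst (∫ x, x ^ 2 * f x ∂γ) * √(2 * lsDeficit f f') := by
  set m := ∫ x, x ^ 2 * f x ∂γ with hm
  suffices hlim : ∀ t, 0 < t → ∫ x, |f' x| ∂γ ≤
      (1 + t) * (stabConst ((1 + t)⁻¹ * (m + t)) * √(2 * mixBound (lsDeficit f f') t)) by
    refine (le_of_forall_pos_le ?_ hlim).trans_eq (by simp [mixBound_zero])
    have := continuousAt_mixBound (lsDeficit f f')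
    unfold stabConst
    fun_prop (disch := simp)
  intro t ht
  obtain ⟨T, hT⟩ := (h.isPosDensity_mix ht).exists_isTransport
  have hmix := (h.isPosDensity_mix ht).integral_abs_deriv_le_of_isTransport hT
  simp_rw [h.integral_sq_mul_mix, ← hm, abs_mul] at hmix
  rw [integral_const_mul, abs_of_pos (by positivity), inv_mul_le_iff₀ (by positivity)] at hmix
  refine hmix.trans (mul_le_mul_of_nonneg_left (mul_le_mul_of_nonneg_left
    (Real.sqrt_le_sqrt ?_) ?_) (by positivity))
  · linarith [h.lsDeficit_mix_le ht]
  · unfold stabConst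
    positivity

end IsDensity

/-! ### Amplitudes -/

theorem sqrt_add_le_sqrt_add_sqrt (a b : ℝ) : √(a + b) ≤ √a + √b := by
  refine Real.sqrt_le_iff.2 ⟨by positivity, ?_⟩
  rw [add_sq, Real.sq_sqrt', Real.sq_sqrt']
  have hab : 0 ≤ 2 * √a * √b := by positivity
  linarith [le_max_left a 0, le_max_left b 0]

theorem rpow_one_fourth_sq {d : ℝ} (hd : 0 ≤ d) : (d ^ (1 / 4 : ℝ)) ^ 2 = √d := by
  rw [← Real.rpow_natCast, ← Real.rpow_mul hd, Real.sqrt_eq_rpow]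
  norm_num

theorem rpow_one_fourth_cube {d : ℝ} (hd : 0 ≤ d) :
    (d ^ (1 / 4 : ℝ)) ^ 3 = d ^ (3 / 4 : ℝ) := by
  rw [← Real.rpow_natCast, ← Real.rpow_mul hd]
  norm_num

theorem rpow_one_fourth_pow_four {d : ℝ} (hd : 0 ≤ d) : (d ^ (1 / 4 : ℝ)) ^ 4 = d := by
  rw [← Real.rpow_natCast, ← Real.rpow_mul hd]
  norm_num

theorem pow_le_add_pow {q : ℝ} (hq : 0 ≤ q) {k n : ℕ} (hk : 1 ≤ k) (hkn : k ≤ n) :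
    q ^ k ≤ q + q ^ n := by
  rcases le_total q 1 with h | h
  · exact (pow_le_of_le_one hq h (by lia)).trans (le_add_of_nonneg_right (pow_nonneg hq n))
  · exact (pow_le_pow_right₀ h hkn).trans (le_add_of_nonneg_left hq)

theorem sqrt_le_rpow_add_rpow {d : ℝ} (hd : 0 ≤ d) :
    √d ≤ d ^ (1 / 4 : ℝ) + d ^ (3 / 4 : ℝ) := by
  rw [← rpow_one_fourth_sq hd, ← rpow_one_fourth_cube hd]
  exact pow_le_add_pow (by positivity) (by norm_num) (by norm_num)

theorem rpow_three_fourths_le_rpow_add {d : ℝ} (hd : 0 ≤ d) :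
    d ^ (3 / 4 : ℝ) ≤ d ^ (1 / 4 : ℝ) + d := by
  nth_rewrite 3 [← rpow_one_fourth_pow_four hd]
  rw [← rpow_one_fourth_cube hd]
  exact pow_le_add_pow (by positivity) (by norm_num) (by norm_num)

/-- A function `v`, with a specified version `w` of its derivative, whose square is a centered
probability density with respect to `γ`. -/
structure IsAmplitude (v w : ℝ → ℝ) : Prop extends IsCenteredDensity γ fun x => v x ^ 2 where
  isPrimitive : IsPrimitive v w
  memLp_deriv : MemLp w 2 γ

/-- The deficit of the amplitude `v` with derivative `w`. It is at least the deficit of `v ^ 2`,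
where the Fisher information `4 w ^ 2` is only counted on `{v ≠ 0}`. -/
noncomputable def ampDeficit (v w : ℝ → ℝ) : ℝ :=
  2 * ∫ x, w x ^ 2 ∂γ - ∫ x, v x ^ 2 * Real.log (v x ^ 2) ∂γ

/-- The constant of the stability estimate for amplitudes with second moment `m`. -/
noncomputable def ampConst (m : ℝ) : ℝ :=
  5 / 2 * √(2 * Real.pi) * (stabConst m * √2) +
    √(2 * Real.pi) * (√(2 * √(2 * Real.pi) * (stabConst m * √2)) * (1 + √(1 + m)))

theorem stabConst_pos (m : ℝ) : 0 < stabConst m := by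
  unfold stabConst
  positivity

theorem stabConst_le {m m' : ℝ} (h : m ≤ m') : stabConst m ≤ stabConst m' := by
  unfold stabConst
  gcongr

theorem ampConst_pos (m : ℝ) : 0 < ampConst m := by
  have := stabConst_pos m
  unfold ampConst
  positivity

namespace IsAmplitude

variable {v w : ℝ → ℝ} (h : IsAmplitude v w)
include h

theorem isPrimitive_sq : IsPrimitive (fun x => v x ^ 2) fun x => 2 * v x * w x := by
  convert h.isPrimitive.mul h.isPrimitive using 2
  all_goals ring

omit h in
theorem fisher_sq_le (x : ℝ) : (2 * v x * w x) ^ 2 / v x ^ 2 ≤ 4 * w x ^ 2 := by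
  rcases eq_or_ne (v x) 0 with hzero | hne
  · simp only [hzero, ne_eq, OfNat.ofNat_ne_zero, not_false_eq_true, zero_pow, div_zero]
    positivity
  · refine le_of_eq ?_
    field_simp
    ring

theorem integrable_deriv_sq_mul : Integrable (fun x => 4 * w x ^ 2) γ :=
  h.memLp_deriv.integrable_sq.const_mul 4

theorem isDensity_sq : IsDensity (fun x => v x ^ 2) fun x => 2 * v x * w x where
  toIsCenteredDensity := h.toIsCenteredDensity
  isPrimitive := h.isPrimitive_sq
  nonneg x := sq_nonneg (v x)
  deriv_eq_zero x hx := by simp [pow_eq_zero_iff two_ne_zero |>.1 hx]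
  integrable_fisher := by
    refine h.integrable_deriv_sq_mul.mono' ?_ (Eventually.of_forall fun x => ?_)
    · have hsq := h.isPrimitive_sq
      exact ((hsq.locallyIntegrable.aestronglyMeasurable.pow 2).div₀
        hsq.continuous.aestronglyMeasurable).mono_ac γ_absolutelyContinuous
    · rw [Real.norm_of_nonneg (by positivity)]
      exact fisher_sq_le x

theorem lsDeficit_sq_le :
    lsDeficit (fun x => v x ^ 2) (fun x => 2 * v x * w x) ≤ ampDeficit v w := by
  have hfisher := integral_mono h.isDensity_sq.integrable_fisher h.integrable_deriv_sq_mul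
    fisher_sq_le
  rw [integral_const_mul] at hfisher
  rw [lsDeficit, ampDeficit]
  linarith

theorem ampDeficit_nonneg : 0 ≤ ampDeficit v w :=
  h.isDensity_sq.lsDeficit_nonneg.trans h.lsDeficit_sq_le

theorem memLp : MemLp v 2 γ :=
  (memLp_two_iff_integrable_sq (h.isPrimitive.continuous.aestronglyMeasurable)).2 h.integrable

theorem integrable_mul_deriv : Integrable (fun x => v x * w x) γ :=
  h.memLp.integrable_mul h.memLp_deriv

theorem integrable_deriv_sq : Integrable (fun x => 2 * v x * w x) γ := by
  simpa only [mul_assoc] using h.integrable_mul_deriv.const_mul 2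

theorem integrable_deriv : Integrable w γ := h.memLp_deriv.integrable one_le_two

theorem integral_abs_sq_sub_one_le :
    ∫ x, |v x ^ 2 - 1| ∂γ ≤ 2 * √(2 * Real.pi) * ∫ x, |2 * v x * w x| ∂γ := by
  simpa only [h.integral_eq_one] using
    h.isPrimitive_sq.integral_abs_sub_mean_le h.integrable_deriv_sq

theorem integral_sq_one_sub_abs_le : ∫ x, (1 - |v x|) ^ 2 ∂γ ≤ ∫ x, |v x ^ 2 - 1| ∂γ := by
  have hmem : MemLp (fun x => 1 - |v x|) 2 γ := (memLp_const 1).sub h.memLp.abs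
  refine integral_mono hmem.integrable_sq (h.integrable.sub (integrable_const 1)).abs fun x => ?_
  have hv := abs_nonneg (v x)
  rw [← sq_abs (v x), ← sq_abs (1 - _), show |v x| ^ 2 - 1 = -((1 - |v x|) * (1 + |v x|)) by ring,
    abs_neg, abs_mul, sq]
  refine mul_le_mul_of_nonneg_left ?_ (abs_nonneg _)
  rw [abs_of_nonneg (by positivity : 0 ≤ 1 + |v x|), abs_le]
  constructor <;> linarith

theorem integral_abs_deriv_le : ∫ x, |w x| ∂γ ≤ 1 / 2 * ∫ x, |2 * v x * w x| ∂γ +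
    √(∫ x, |v x ^ 2 - 1| ∂γ) * √(∫ x, w x ^ 2 ∂γ) := by
  have hmem : MemLp (fun x => 1 - |v x|) 2 γ := (memLp_const 1).sub h.memLp.abs
  have hsplit (x : ℝ) : |w x| ≤ 1 / 2 * |2 * v x * w x| + |(1 - |v x|) * w x| := by
    have := mul_le_mul_of_nonneg_right (le_abs_self (1 - |v x|)) (abs_nonneg (w x))
    rw [abs_mul, abs_mul, abs_mul, abs_two]
    linarith
  have habs := h.integrable_deriv_sq.abs.const_mul (1 / 2)
  have hmul : Integrable (fun x => |(1 - |v x|) * w x|) γ :=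
    (hmem.integrable_mul h.memLp_deriv).abs
  have hint := integral_mono h.integrable_deriv.abs (habs.add hmul) hsplit
  simp only [Pi.add_apply] at hint
  rw [integral_add habs hmul, integral_const_mul] at hint
  refine hint.trans (add_le_add_right
    ((integral_abs_mul_le_sqrt_mul_sqrt hmem h.memLp_deriv).trans ?_) _)
  gcongr ?_ * _
  exact Real.sqrt_le_sqrt h.integral_sq_one_sub_abs_le

variable {m : ℝ} (hm : ∫ x, x ^ 2 * v x ^ 2 ∂γ ≤ m)
include hm

theorem integral_sq_deriv_le : ∫ x, w x ^ 2 ∂γ ≤ ampDeficit v w + (1 + m) := by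
  have hent := h.isDensity_sq.integral_mul_log_le
  have hle := h.lsDeficit_sq_le
  rw [ampDeficit] at hle ⊢
  linarith

theorem integral_abs_deriv_sq_le :
    ∫ x, |2 * v x * w x| ∂γ ≤ stabConst m * √2 * √(ampDeficit v w) :=
  calc ∫ x, |2 * v x * w x| ∂γ
      ≤ stabConst (∫ x, x ^ 2 * v x ^ 2 ∂γ) *
          √(2 * lsDeficit (fun x => v x ^ 2) fun x => 2 * v x * w x) :=
        h.isDensity_sq.integral_abs_deriv_le
    _ ≤ stabConst m * √(2 * ampDeficit v w) :=
        mul_le_mul (stabConst_le hm) (Real.sqrt_le_sqrt (by linarith [h.lsDeficit_sq_le]))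
          (Real.sqrt_nonneg _) (stabConst_pos m).le
    _ = stabConst m * √2 * √(ampDeficit v w) := by
        rw [Real.sqrt_mul zero_le_two, mul_assoc]

theorem sqrt_integral_abs_sq_sub_one_le : √(∫ x, |v x ^ 2 - 1| ∂γ) ≤
    √(2 * √(2 * Real.pi) * (stabConst m * √2)) * ampDeficit v w ^ (1 / 4 : ℝ) := by
  have hC := stabConst_pos m
  have hd := h.ampDeficit_nonneg
  refine Real.sqrt_le_iff.2 ⟨by positivity, ?_⟩
  rw [mul_pow, Real.sq_sqrt (by positivity), rpow_one_fourth_sq hd, mul_assoc]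
  exact h.integral_abs_sq_sub_one_le.trans
    (mul_le_mul_of_nonneg_left (h.integral_abs_deriv_sq_le hm) (by positivity))

theorem sqrt_integral_sq_deriv_le :
    √(∫ x, w x ^ 2 ∂γ) ≤ (ampDeficit v w ^ (1 / 4 : ℝ)) ^ 2 + √(1 + m) := by
  rw [rpow_one_fourth_sq h.ampDeficit_nonneg]
  exact (Real.sqrt_le_sqrt (h.integral_sq_deriv_le hm)).trans
    (sqrt_add_le_sqrt_add_sqrt _ _)

theorem integral_abs_sub_one_add_integral_abs_deriv_le :
    ∫ x, |v x ^ 2 - 1| ∂γ + √(2 * Real.pi) * ∫ x, |w x| ∂γ ≤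
      ampConst m * (ampDeficit v w ^ (1 / 4 : ℝ) + ampDeficit v w ^ (3 / 4 : ℝ)) := by
  have hd := h.ampDeficit_nonneg
  have hC := stabConst_pos m
  have hL := h.integral_abs_deriv_sq_le hm
  have hN := h.integral_abs_sq_sub_one_le
  have hw := h.integral_abs_deriv_le
  have hNW := mul_le_mul (h.sqrt_integral_abs_sq_sub_one_le hm) (h.sqrt_integral_sq_deriv_le hm)
    (Real.sqrt_nonneg _) (by positivity)
  rw [← rpow_one_fourth_sq hd] at hL
  rw [← rpow_one_fourth_cube hd, ampConst]
  set q := ampDeficit v w ^ (1 / 4 : ℝ)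
  set s := √(2 * Real.pi)
  set A := stabConst m * √2
  have hq : 0 ≤ q := by positivity
  calc ∫ x, |v x ^ 2 - 1| ∂γ + s * ∫ x, |w x| ∂γ
      ≤ 2 * s * ∫ x, |2 * v x * w x| ∂γ + s * (1 / 2 * ∫ x, |2 * v x * w x| ∂γ +
          √(2 * s * A) * q * (q ^ 2 + √(1 + m))) :=
        add_le_add hN (mul_le_mul_of_nonneg_left (hw.trans (add_le_add_right hNW _))
          (by positivity))
    _ = 5 / 2 * s * ∫ x, |2 * v x * w x| ∂γ + s * (√(2 * s * A) *
          (q ^ 3 + q * √(1 + m))) := by ring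
    _ ≤ 5 / 2 * s * (A * (q + q ^ 3)) + s * (√(2 * s * A) *
          ((q + q ^ 3) + (q + q ^ 3) * √(1 + m))) := by
        gcongr
        · exact hL.trans (mul_le_mul_of_nonneg_left
            (pow_le_add_pow hq one_le_two (by norm_num)) (by positivity))
        · exact le_add_of_nonneg_left hq
        · exact le_add_of_nonneg_right (by positivity)
    _ = _ := by ring

end IsAmplitude

/-! ### Weak formulation and rescaling -/

theorem HasPosDensity.ae_eq {μ : Measure ℝ} {g : ℝ → ℝ} (h : HasPosDensity μ g) :
    ae μ = ae volume := by
  rw [h.eq_withDensity]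
  refine le_antisymm (withDensity_absolutelyContinuous _ _).ae_le
    (withDensity_absolutelyContinuous' ?_ ?_).ae_le
  · exact h.continuous.measurable.ennreal_ofReal.aemeasurable
  · exact Eventually.of_forall fun x => (ENNReal.ofReal_pos.2 (h.pos x)).ne'

theorem IsCenteredDensity.congr {μ : Measure ℝ} {f g : ℝ → ℝ} (h : IsCenteredDensity μ f)
    (hfg : f =ᵐ[μ] g) : IsCenteredDensity μ g where
  integrable := h.integrable.congr hfg
  integral_eq_one := (integral_congr_ae hfg).symm.trans h.integral_eq_one
  integral_mul_eq_zero :=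
    (integral_congr_ae ((EventuallyEq.refl _ id).mul hfg)).symm.trans h.integral_mul_eq_zero
  integrable_sq_mul := h.integrable_sq_mul.congr ((EventuallyEq.refl _ (· ^ 2)).mul hfg)

theorem HasWeakDeriv.w11Norm_eq {μ : Measure ℝ} {u w : ℝ → ℝ} (h : HasWeakDeriv u w)
    (hμ : μ ≪ volume) : w11Norm μ u = ∫ x, |u x| ∂μ + ∫ x, |w x| ∂μ := by
  have hderiv : ∀ᵐ x ∂μ, |weakDeriv u x| = |w x| :=
    (hμ.ae_eq h.weakDeriv_ae_eq).fun_comp abs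
  rw [w11Norm, integral_congr_ae hderiv]

theorem HasWeakDeriv.memW1p_one {μ : Measure ℝ} {u w : ℝ → ℝ} (h : HasWeakDeriv u w)
    (hu : Integrable u μ) (hw : Integrable w μ) : MemW1p 1 μ u :=
  ⟨memLp_one_iff_integrable.2 hu, w, h, memLp_one_iff_integrable.2 hw⟩

theorem IsPrimitive.hasWeakDeriv_sub_one {v w u : ℝ → ℝ} (h : IsPrimitive v w)
    (hvu : v =ᵐ[volume] u) : HasWeakDeriv (fun x => u x - 1) w := by
  have hsub : IsPrimitive (fun x => v x - 1) w := by simpa only [sub_zero] using h.sub (.const 1)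
  exact hsub.hasWeakDeriv.congr (hvu.sub .rfl)

section Density

variable {f : ℝ → ℝ} (hf : IsCenteredDensity γ f) (hpos : ∀ᵐ x ∂γ, 0 ≤ f x)
  (hsob : MemW1p 2 γ fun x => √(f x))

include hf hpos hsob in
theorem exists_isAmplitude_sq_ae_eq :
    ∃ v w, IsAmplitude v w ∧ (fun x => v x ^ 2) =ᵐ[volume] f := by
  obtain ⟨-, w, hw, hw2⟩ := hsob
  obtain ⟨v, hv, hprim⟩ := hw.exists_isPrimitive
  rw [hasPosDensity_γ.ae_eq] at hpos
  have hsq : (fun x => v x ^ 2) =ᵐ[volume] f := by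
    filter_upwards [hv, hpos] with x hx hx0
    rw [hx, Real.sq_sqrt hx0]
  exact ⟨v, w, ⟨hf.congr (γ_absolutelyContinuous.ae_eq hsq.symm), hprim, hw2⟩, hsq⟩

variable {v w : ℝ → ℝ} (h : IsAmplitude v w) (hsq : (fun x => v x ^ 2) =ᵐ[volume] f)
include h hsq

theorem IsAmplitude.fisherIntegrand_ae_eq :
    (fun x => (2 * v x * w x) ^ 2 / v x ^ 2) =ᵐ[γ] fisherIntegrand f := by
  refine γ_absolutelyContinuous.ae_eq ?_
  filter_upwards [(h.isPrimitive_sq.hasWeakDeriv.congr hsq).weakDeriv_ae_eq, hsq] with x hx hfx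
  rw [fisherIntegrand, hx, ← hfx]

theorem IsAmplitude.deficit_eq :
    deficit f = lsDeficit (fun x => v x ^ 2) fun x => 2 * v x * w x := by
  have hlog : ∀ᵐ x ∂γ, v x ^ 2 * Real.log (v x ^ 2) = f x * Real.log (f x) :=
    (γ_absolutelyContinuous.ae_eq hsq).fun_comp fun t => t * Real.log t
  rw [deficit, lsDeficit, integral_congr_ae (h.fisherIntegrand_ae_eq hsq),
    integral_congr_ae hlog]

theorem IsAmplitude.w11Norm_sq_sub_one_le : w11Norm γ (fun x => f x - 1) ≤
    (2 * √(2 * Real.pi) + 1) * stabConst (∫ x, x ^ 2 * f x ∂γ) * √2 * √(deficit f) := by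
  have hmoment : ∫ x, x ^ 2 * v x ^ 2 ∂γ = ∫ x, x ^ 2 * f x ∂γ :=
    integral_congr_ae ((EventuallyEq.refl _ (· ^ 2)).mul (γ_absolutelyContinuous.ae_eq hsq))
  have habs : ∀ᵐ x ∂γ, |f x - 1| = |v x ^ 2 - 1| :=
    (γ_absolutelyContinuous.ae_eq hsq.symm).fun_comp fun t => |t - 1|
  rw [(h.isPrimitive_sq.hasWeakDeriv_sub_one hsq).w11Norm_eq γ_absolutelyContinuous,
    integral_congr_ae habs, h.deficit_eq hsq, mul_assoc _ √2, ← Real.sqrt_mul zero_le_two,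
    ← hmoment, mul_assoc]
  calc ∫ x, |v x ^ 2 - 1| ∂γ + ∫ x, |2 * v x * w x| ∂γ
      ≤ (2 * √(2 * Real.pi) + 1) * ∫ x, |2 * v x * w x| ∂γ := by
        linarith [h.integral_abs_sq_sub_one_le]
    _ ≤ _ := mul_le_mul_of_nonneg_left h.isDensity_sq.integral_abs_deriv_le (by positivity)

end Density

section Rescaling

theorem sqrt_two_pi_pos : 0 < √(2 * Real.pi) := by positivity

theorem γπ_absolutelyContinuous : γπ ≪ volume := withDensity_absolutelyContinuous _ _

theorem γπ_eq_map : γπ = γ.map (fun x => x / √(2 * Real.pi)) := by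
  have hvar : (NNReal.mk (√(2 * Real.pi) ^ 2) (sq_nonneg _) : ℝ) = 2 * Real.pi :=
    Real.sq_sqrt (by positivity)
  rw [γ, gaussianReal_map_div_const, gaussianReal_of_var_ne_zero, γπ]
  · congr 1
    ext x
    rw [gaussianPDF, gaussianPDFReal, NNReal.coe_div, NNReal.coe_one, hvar,
      mul_one_div_cancel (by positivity), Real.sqrt_one, inv_one, one_mul, zero_div, sub_zero]
    congr 2
    field_simp
  · refine (div_pos one_pos ?_).ne'
    rw [← NNReal.coe_pos, hvar]
    positivity

instance : IsProbabilityMeasure γπ := by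
  rw [γπ_eq_map]
  exact Measure.isProbabilityMeasure_map (by fun_prop)

theorem measurableEmbedding_div_sqrt_two_pi :
    MeasurableEmbedding fun x : ℝ => x / √(2 * Real.pi) := by
  simp only [div_eq_mul_inv]
  exact measurableEmbedding_mulRight₀ (inv_ne_zero sqrt_two_pi_pos.ne')

theorem integral_γπ (φ : ℝ → ℝ) : ∫ x, φ x ∂γπ = ∫ x, φ (x / √(2 * Real.pi)) ∂γ := by
  rw [γπ_eq_map, measurableEmbedding_div_sqrt_two_pi.integral_map]

theorem integrable_γπ_iff {φ : ℝ → ℝ} :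
    Integrable φ γπ ↔ Integrable (fun x => φ (x / √(2 * Real.pi))) γ := by
  rw [γπ_eq_map, measurableEmbedding_div_sqrt_two_pi.integrable_map_iff, Function.comp_def]

theorem IsPrimitive.comp_div {v w : ℝ → ℝ} (h : IsPrimitive v w) {c : ℝ} (hc : c ≠ 0) :
    IsPrimitive (fun x => v (x / c)) fun x => w (x / c) / c := by
  have hint (a b : ℝ) : IntervalIntegrable (fun x => w (x / c) / c) volume a b := by
    have hmul := (h.intervalIntegrable (a / c) (b / c)).comp_mul_right (c := c⁻¹)
    simp only [div_eq_mul_inv, inv_inv, inv_mul_cancel_right₀ hc] at hmul ⊢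
    exact hmul.mul_const _
  refine ⟨fun x => ⟨Ioc (x - 1) (x + 1), Ioc_mem_nhds (by linarith) (by linarith),
    (hint _ _).1⟩, fun a b => ?_⟩
  rw [intervalIntegral.integral_div, intervalIntegral.integral_comp_div _ hc, smul_eq_mul,
    h.integral_eq_sub, mul_div_cancel_left₀ _ hc]

theorem mul_comp_div_sqrt_two_pi (f : ℝ → ℝ) (x : ℝ) (k : ℕ) :
    x ^ k * f (x / √(2 * Real.pi)) = √(2 * Real.pi) ^ k *
      ((x / √(2 * Real.pi)) ^ k * f (x / √(2 * Real.pi))) := by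
  rw [← mul_assoc, ← mul_pow, mul_div_cancel₀ _ sqrt_two_pi_pos.ne']

theorem integral_pow_mul_comp_div (f : ℝ → ℝ) (k : ℕ) :
    ∫ x, x ^ k * f (x / √(2 * Real.pi)) ∂γ = √(2 * Real.pi) ^ k * ∫ x, x ^ k * f x ∂γπ := by
  rw [integral_γπ fun x => x ^ k * f x, ← integral_const_mul]
  simp only [← mul_comp_div_sqrt_two_pi]

theorem IsCenteredDensity.comp_div {f : ℝ → ℝ} (h : IsCenteredDensity γπ f) :
    IsCenteredDensity γ fun x => f (x / √(2 * Real.pi)) where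
  integrable := integrable_γπ_iff.1 h.integrable
  integral_eq_one := (integral_γπ f).symm.trans h.integral_eq_one
  integral_mul_eq_zero := by
    have hfirst := integral_pow_mul_comp_div f 1
    simp only [pow_one] at hfirst
    rw [hfirst, h.integral_mul_eq_zero, mul_zero]
  integrable_sq_mul := by
    simp only [mul_comp_div_sqrt_two_pi f _ 2]
    exact (integrable_γπ_iff.1 h.integrable_sq_mul).const_mul _

end Rescaling

section Amplitude

variable {u v w : ℝ → ℝ}

theorem IsPrimitive.isAmplitude_comp_div (h : IsPrimitive v w)
    (hv : IsCenteredDensity γπ fun x => v x ^ 2) (hw : MemLp w 2 γπ) :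
    IsAmplitude (fun x => v (x / √(2 * Real.pi)))
      fun x => w (x / √(2 * Real.pi)) / √(2 * Real.pi) where
  toIsCenteredDensity := hv.comp_div
  isPrimitive := h.comp_div sqrt_two_pi_pos.ne'
  memLp_deriv := by
    rw [γπ_eq_map] at hw
    have hcomp := measurableEmbedding_div_sqrt_two_pi.memLp_map_measure_iff.1 hw
    simpa only [div_eq_inv_mul, Function.comp_def] using hcomp.const_mul (√(2 * Real.pi))⁻¹

theorem HasWeakDeriv.deficitStar_eq (h : HasWeakDeriv u w) (hvu : v =ᵐ[volume] u) :
    deficitStar u = ampDeficit (fun x => v (x / √(2 * Real.pi)))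
      fun x => w (x / √(2 * Real.pi)) / √(2 * Real.pi) := by
  have hsq : ∀ᵐ x ∂γπ, weakDeriv u x ^ 2 = w x ^ 2 :=
    (γπ_absolutelyContinuous.ae_eq h.weakDeriv_ae_eq).fun_comp (· ^ 2)
  have hlog : ∀ᵐ x ∂γπ, u x ^ 2 * Real.log (u x ^ 2) = v x ^ 2 * Real.log (v x ^ 2) :=
    (γπ_absolutelyContinuous.ae_eq hvu.symm).fun_comp fun t => t ^ 2 * Real.log (t ^ 2)
  rw [deficitStar, ampDeficit, integral_congr_ae hsq, integral_congr_ae hlog,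
    integral_γπ fun x => w x ^ 2, integral_γπ fun x => v x ^ 2 * Real.log (v x ^ 2)]
  simp only [div_pow, Real.sq_sqrt (by positivity : 0 ≤ 2 * Real.pi)]
  rw [integral_div]
  field_simp

theorem integral_abs_sub_one_le_integral_abs_sq_sub_one (hpos : ∀ᵐ x ∂γπ, 0 ≤ u x)
    (hu : MemLp u 2 γπ) : ∫ x, |u x - 1| ∂γπ ≤ ∫ x, |u x ^ 2 - 1| ∂γπ := by
  refine integral_mono_ae ((hu.integrable one_le_two).sub (integrable_const 1)).abs
    (hu.integrable_sq.sub (integrable_const 1)).abs ?_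
  filter_upwards [hpos] with x hx
  rw [show u x ^ 2 - 1 = (u x - 1) * (u x + 1) by ring, abs_mul]
  exact le_mul_of_one_le_right (abs_nonneg _) ((by linarith : 1 ≤ u x + 1).trans (le_abs_self _))

theorem IsPrimitive.w11Norm_γπ_sub_one_le (h : IsPrimitive v w) (hvu : v =ᵐ[volume] u)
    (hpos : ∀ᵐ x ∂γπ, 0 ≤ u x) (hu : MemLp u 2 γπ) : w11Norm γπ (fun x => u x - 1) ≤
      ∫ x, |v (x / √(2 * Real.pi)) ^ 2 - 1| ∂γ +
        √(2 * Real.pi) * ∫ x, |w (x / √(2 * Real.pi)) / √(2 * Real.pi)| ∂γ := by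
  have habs : ∀ᵐ x ∂γπ, |u x ^ 2 - 1| = |v x ^ 2 - 1| :=
    (γπ_absolutelyContinuous.ae_eq hvu.symm).fun_comp fun t => |t ^ 2 - 1|
  rw [(h.hasWeakDeriv_sub_one hvu).w11Norm_eq γπ_absolutelyContinuous,
    ← integral_γπ fun x => |v x ^ 2 - 1|, ← integral_congr_ae habs, ← integral_const_mul,
    integral_γπ fun x => |w x|]
  simp only [abs_div, abs_of_pos sqrt_two_pi_pos, mul_div_cancel₀ _ sqrt_two_pi_pos.ne']
  exact add_le_add_left (integral_abs_sub_one_le_integral_abs_sq_sub_one hpos hu) _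

end Amplitude

theorem stability_density {α : ℝ} {f : ℝ → ℝ} (hf : IsCenteredDensity γ f)
    (hpos : ∀ᵐ x ∂γ, 0 ≤ f x) (hsob : MemW1p 2 γ fun x => √(f x))
    (hα : ∫ x, x ^ 2 * f x ∂γ ≤ α) :
    Integrable (fisherIntegrand f) γ ∧ Integrable (fun x => f x * Real.log (f x)) γ ∧
      0 ≤ deficit f ∧ MemW1p 1 γ (fun x => f x - 1) ∧
      w11Norm γ (fun x => f x - 1) ≤
        (2 * √(2 * Real.pi) + 1) * stabConst α * √2 * √(deficit f) := by
  obtain ⟨v, w, h, hsq⟩ := exists_isAmplitude_sq_ae_eq hf hpos hsob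
  refine ⟨h.isDensity_sq.integrable_fisher.congr (h.fisherIntegrand_ae_eq hsq),
    h.isDensity_sq.integrable_mul_log.congr
      ((γ_absolutelyContinuous.ae_eq hsq).fun_comp fun t => t * Real.log t),
    h.deficit_eq hsq ▸ h.isDensity_sq.lsDeficit_nonneg,
    (h.isPrimitive_sq.hasWeakDeriv_sub_one hsq).memW1p_one
      (hf.integrable.sub (integrable_const 1)) h.integrable_deriv_sq,
    (h.w11Norm_sq_sub_one_le hsq).trans ?_⟩
  gcongr
  exact stabConst_le hα

theorem stability_amplitude {α : ℝ} {u : ℝ → ℝ} (hu : IsCenteredDensity γπ fun x => u x ^ 2)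
    (hpos : ∀ᵐ x ∂γπ, 0 ≤ u x) (hsob : MemW1p 2 γπ u) (hα : ∫ x, x ^ 2 * u x ^ 2 ∂γπ ≤ α) :
    Integrable (fun x => u x ^ 2 * Real.log (u x ^ 2)) γπ ∧ 0 ≤ deficitStar u ∧
      MemW1p 1 γπ (fun x => u x - 1) ∧
      w11Norm γπ (fun x => u x - 1) ≤ ampConst (2 * Real.pi * α) *
        (deficitStar u ^ (1 / 4 : ℝ) + deficitStar u ^ (3 / 4 : ℝ)) := by
  obtain ⟨hu2, w, hw, hw2⟩ := hsob
  obtain ⟨v, hvu, hprim⟩ := hw.exists_isPrimitive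
  have hsq : (fun x => v x ^ 2) =ᵐ[volume] fun x => u x ^ 2 :=
    hvu.fun_comp (· ^ 2)
  have hsqπ := γπ_absolutelyContinuous.ae_eq hsq
  have h := hprim.isAmplitude_comp_div (hu.congr hsqπ.symm) hw2
  have hmoment : ∫ x, x ^ 2 * v (x / √(2 * Real.pi)) ^ 2 ∂γ ≤ 2 * Real.pi * α := by
    have hcongr : ∫ x, x ^ 2 * v x ^ 2 ∂γπ = ∫ x, x ^ 2 * u x ^ 2 ∂γπ :=
      integral_congr_ae ((EventuallyEq.refl _ (· ^ 2)).mul hsqπ)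
    rw [integral_pow_mul_comp_div (fun x => v x ^ 2), Real.sq_sqrt (by positivity), hcongr]
    exact mul_le_mul_of_nonneg_left hα (by positivity)
  rw [hw.deficitStar_eq hvu]
  exact ⟨(integrable_γπ_iff.2 h.isDensity_sq.integrable_mul_log).congr
      (hsqπ.fun_comp fun t => t * Real.log t),
    h.ampDeficit_nonneg,
    (hprim.hasWeakDeriv_sub_one hvu).memW1p_one
      ((hu2.integrable one_le_two).sub (integrable_const 1)) (hw2.integrable one_le_two),
    (hprim.w11Norm_γπ_sub_one_le hvu hpos hu2).trans
      (h.integral_abs_sub_one_add_integral_abs_deriv_le hmoment)⟩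

end LSIStability

open LSIStability in
theorem theorem1p1_general :
    (∀ α : ℝ, ∃ a : ℝ, 0 < a ∧ ∀ f : ℝ → ℝ,
      IsCenteredDensity γ f → (∀ᵐ x ∂γ, 0 ≤ f x) → MemW1p 2 γ (fun x => √(f x)) →
      ∫ x, x ^ 2 * f x ∂γ ≤ α →
        Integrable (fisherIntegrand f) γ ∧ Integrable (fun x => f x * Real.log (f x)) γ ∧
        0 ≤ deficit f ∧ MemW1p 1 γ (fun x => f x - 1) ∧
        w11Norm γ (fun x => f x - 1) ≤ a * √(deficit f)) ∧
    (∀ α : ℝ, ∃ a : ℝ, 0 < a ∧ ∀ u : ℝ → ℝ,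
      IsCenteredDensity γπ (fun x => u x ^ 2) → (∀ᵐ x ∂γπ, 0 ≤ u x) → MemW1p 2 γπ u →
      ∫ x, x ^ 2 * u x ^ 2 ∂γπ ≤ α →
        Integrable (fun x => u x ^ 2 * Real.log (u x ^ 2)) γπ ∧
        0 ≤ deficitStar u ∧ MemW1p 1 γπ (fun x => u x - 1) ∧
        w11Norm γπ (fun x => u x - 1) ≤
          a * (deficitStar u ^ (1 / 4 : ℝ) + deficitStar u ^ (3 / 4 : ℝ))) := by
  refine ⟨fun α => ⟨_, ?_, fun f => stability_density⟩,
    fun α => ⟨_, ampConst_pos (2 * Real.pi * α), fun u => stability_amplitude⟩⟩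
  have := stabConst_pos α
  positivity

theorem theorem1p1 :
    (∀ α : ℝ, ∃ a : ℝ, 0 < a ∧ ∀ f : ℝ → ℝ,
      (∀ᵐ x ∂LSIStability.γ, 0 ≤ f x) →
      Integrable f LSIStability.γ →
      LSIStability.MemW1p 2 LSIStability.γ (fun x => Real.sqrt (f x)) →
      ∫ x, f x ∂LSIStability.γ = 1 →
      ∫ x, x * f x ∂LSIStability.γ = 0 →
      Integrable (fun x => |x| ^ 2 * f x) LSIStability.γ →
      ∫ x, |x| ^ 2 * f x ∂LSIStability.γ ≤ α →
        Integrable (LSIStability.fisherIntegrand f) LSIStability.γ ∧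
        Integrable (fun x => f x * Real.log (f x)) LSIStability.γ ∧
        0 ≤ LSIStability.deficit f ∧
        LSIStability.MemW1p 1 LSIStability.γ (fun x => f x - 1) ∧
        LSIStability.w11Norm LSIStability.γ (fun x => f x - 1) ≤
          a * (LSIStability.deficit f ^ (1 / 4 : ℝ) + LSIStability.deficit f ^ (3 / 4 : ℝ))) ∧
    (∀ α : ℝ, ∃ a : ℝ, 0 < a ∧ ∀ u : ℝ → ℝ,
      (∀ᵐ x ∂LSIStability.γπ, 0 ≤ u x) →
      LSIStability.MemW1p 2 LSIStability.γπ u →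
      ∫ x, u x ^ 2 ∂LSIStability.γπ = 1 →
      ∫ x, x * u x ^ 2 ∂LSIStability.γπ = 0 →
      Integrable (fun x => |x| ^ 2 * u x ^ 2) LSIStability.γπ →
      ∫ x, |x| ^ 2 * u x ^ 2 ∂LSIStability.γπ ≤ α →
        Integrable (fun x => u x ^ 2 * Real.log (u x ^ 2)) LSIStability.γπ ∧
        0 ≤ LSIStability.deficitStar u ∧
        LSIStability.MemW1p 1 LSIStability.γπ (fun x => u x - 1) ∧
        LSIStability.w11Norm LSIStability.γπ (fun x => u x - 1) ≤
          a * (LSIStability.deficitStar u ^ (1 / 4 : ℝ) + LSIStability.deficitStar u)) := by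
  obtain ⟨hdensity, hamplitude⟩ := theorem1p1_general
  refine ⟨fun α => ?_, fun α => ?_⟩
  · obtain ⟨a, ha, hstab⟩ := hdensity α
    refine ⟨a, ha, fun f hpos hf hsob hmass hmean hsecond hα => ?_⟩
    simp only [sq_abs] at hsecond hα
    obtain ⟨hfisher, hlog, hdeficit, hmem, hle⟩ :=
      hstab f ⟨hf, hmass, hmean, hsecond⟩ hpos hsob hα
    refine ⟨hfisher, hlog, hdeficit, hmem, hle.trans ?_⟩
    gcongr
    exact LSIStability.sqrt_le_rpow_add_rpow hdeficit
  · obtain ⟨a, ha, hstab⟩ := hamplitude α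
    refine ⟨a * 2, by positivity, fun u hpos hsob hmass hmean hsecond hα => ?_⟩
    simp only [sq_abs] at hsecond hα
    obtain ⟨hlog, hdeficit, hmem, hle⟩ :=
      hstab u ⟨hsob.1.integrable_sq, hmass, hmean, hsecond⟩ hpos hsob hα
    refine ⟨hlog, hdeficit, hmem, hle.trans ?_⟩
    rw [mul_assoc]
    gcongr
    linarith [LSIStability.rpow_three_fourths_le_rpow_add hdeficit]
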